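/- Let $p>1$ be an integer. For $z=re^{i\theta}\in\mathbb C$ with $r>0$, $\theta\in(-\pi,\pi]$, and $j\in\{0,\dots,p-1\}$, let $f_j(z)=r^{1/p}e^{i(\theta+2\pi j)/p}$ be the $(j+1)$st branch of the $p$th-root function, with derivatives $$f_j^{(k)}(z)=\frac1{p^k}\prod_{i=0}^{k-1}(1-ip)\; r^{(1-kp)/p}\,e^{i[2\pi j+\theta(1-kp)]/p}\qquad(k\ge 0).$$ Let $J_m(\lambda)$ be the $m\times m$ (upper triangular) Jordan block with eigenvalue $\lambda$, and for $\lambda\neq0$ let $f_j(J_m(\lambda))$ be the upper triangular Toeplitz matrix with $f_j^{(d)}(\lambda)/d!$ on the $d$th superdiagonal, $0\le d<m$. For $\lambda\in\mathbb C$ let $C_m(\lambda)\in M_{2m}(\mathbb R)$ be the block upper triangular matrix with diagonal blocks $\begin{bmatrix}\operatorname{Re}\lambda&\operatorname{Im}\lambda\\-\operatorname{Im}\lambda&\operatorname{Re}\lambda\end{bmatrix}$, blocks $I_2$ on the first block superdiagonal, and zeros elsewhere. Put $$F_{(j_1,j_2)}(C_m(\lambda))=S_mP_m\begin{bmatrix}f_{j_1}(J_m(\lambda))&0\\0&f_{j_2}(J_m(\bar\lambda))\end{bmatrix}P_m^TS_m^{-1},$$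 where $S_m=\bigoplus_{i=1}^m\begin{bmatrix}-i&-i\\1&-1\end{bmatrix}$ (in this $2\times2$ matrix $i$ denotes the imaginary unit) and $P_m=[e_1\,e_3\cdots e_{2m-1}\,e_2\,e_4\cdots e_{2m}]$. **Theorem.** Let $A\in M_n(\mathbb R)$ be nonsingular, and let $s$ be the number of distinct complex eigenvalues of $A$. Call a matrix $X\in M_n(\mathbb C)$ with $X^p=A$ a *primary* $p$th root of $A$ if $X$ is a polynomial in $A$ with complex coefficients, and a *nonprimary* $p$th root otherwise. Then $A$ has a real Jordan canonical form: there are a real invertible matrix $R$ and integers $r,c\ge0$ with $$R^{-1}AR=J_{\mathbb R}=\bigoplus_{k=1}^rJ_{n_k}(\lambda_k)\;\oplus\;\bigoplus_{k=r+1}^{r+c}C_{n_k}(\lambda_k),$$ where $n_k\ge1$, $\lambda_k\in\mathbb R$ for $k\le r$, and $\lambda_k\in\mathbb C\setminus\mathbb R$ for $k>r$. The matrix $A$ has precisely $p^s$ primary $p$th roots. Moreover, let any such real Jordan canonical form of $A$ be given. It has $t=r+2c$ associated complex Jordan blocks: $J_{n_k}(\lambda_k)$ for $k\le r$, and both $J_{n_k}(\lambda_k)$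 and $J_{n_k}(\bar\lambda_k)$ for $k>r$. A *branch choice* $j$ assigns an element of $\{0,\dots,p-1\}$ to each of these $t$ blocks; write $j_k$ for its value at $J_{n_k}(\lambda_k)$ if $k\le r$, and $j_k=(j_{k_1},j_{k_2})$ for its values at $J_{n_k}(\lambda_k)$ and $J_{n_k}(\bar\lambda_k)$ if $k>r$. Then: 1. The primary $p$th roots of $A$ are exactly the matrices $$X_j=R\Big(\bigoplus_{k=1}^rf_{j_k}(J_{n_k}(\lambda_k))\oplus\bigoplus_{k=r+1}^{r+c}F_{j_k}(C_{n_k}(\lambda_k))\Big)R^{-1},$$ where $j$ runs over the branch choices that take equal values at any two of the $t$ blocks with equal eigenvalues. 2. If $A$ is derogatory, i.e. $s<t$, then $A$ has nonprimary $p$th roots. 3. The nonprimary $p$th roots of $A$ are exactly the matrices $$X_j(U)=RU\Big(\bigoplus_{k=1}^rf_{j_k}(J_{n_k}(\lambda_k))\oplus\bigoplus_{k=r+1}^{r+c}F_{j_k}(C_{n_k}(\lambda_k))\Big)U^{-1}R^{-1},$$ where $U$ is an arbitrary nonsingular complex matrix that commutes with $J_{\mathbb R}$, and $j$ is an arbitrary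 branch choice that takes different values at some two of the $t$ blocks with equal eigenvalues. -/

import Mathlib

open scoped Kronecker ComplexConjugate

namespace MatrixRoots

/-- The `k`-th derivative at `z = r exp (i θ)`, `r = ‖z‖ > 0`, `θ = arg z ∈ (-π, π]`, of the `j`-th
branch `f_j (z) = r ^ (1/p) exp (i (θ + 2 π j) / p)` of the `p`-th root function:
`p ^ (-k) ∏_{i < k} (1 - i p) r ^ ((1 - k p) / p) exp (i (2 π j + θ (1 - k p)) / p)`.
The value `f_j (z)` itself is the case `k = 0`. On the negative real axis, where the principal
argument jumps, this is the derivative of the branch continued analytically from above. -/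
noncomputable def branchDeriv (p j k : ℕ) (z : ℂ) : ℂ :=
  1 / (p : ℂ) ^ k * (∏ i ∈ Finset.range k, (1 - (i : ℂ) * p)) *
    (((‖z‖ ^ ((1 - (k : ℝ) * p) / p) : ℝ) : ℂ) *
      Complex.exp (Complex.I * (2 * Real.pi * j + Complex.arg z * (1 - k * p)) / p))

/-- The nilpotent `m × m` matrix with ones on the first superdiagonal. -/
def shift (S : Type*) [Zero S] [One S] (m : ℕ) : Matrix (Fin m) (Fin m) S :=
  Matrix.of fun a b => if (a : ℕ) + 1 = b then 1 else 0

/-- The real Jordan block `J_m (x)` of a real eigenvalue `x`. -/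
def jordanBlock (m : ℕ) (x : ℝ) : Matrix (Fin m) (Fin m) ℝ :=
  Matrix.scalar (Fin m) x + shift ℝ m

/-- The matrix `f_j (J_m (z))`: upper triangular Toeplitz, with the entry
`f_j^{(d)} (z) / d!` on the `d`-th superdiagonal. -/
noncomputable def branchBlock (p j m : ℕ) (z : ℂ) : Matrix (Fin m) (Fin m) ℂ :=
  Matrix.of fun a b =>
    if (a : ℕ) ≤ b then
      branchDeriv p j ((b : ℕ) - a) z / (Nat.factorial ((b : ℕ) - a) : ℂ)
    else 0

/-- The real `2 × 2` matrix `C (z)`. -/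
def rotBlock (z : ℂ) : Matrix (Fin 2) (Fin 2) ℝ :=
  !![z.re, z.im; -z.im, z.re]

/-- The real `2m × 2m` matrix `C_m (z)`, with `m` diagonal blocks `C (z)` and identity blocks `I_2`
on the first block superdiagonal. The row `(a, u)` is the `u`-th row of the `a`-th block row. -/
def realJordanBlock (m : ℕ) (z : ℂ) : Matrix (Fin m × Fin 2) (Fin m × Fin 2) ℝ :=
  (1 : Matrix (Fin m) (Fin m) ℝ) ⊗ₖ rotBlock z + shift ℝ m ⊗ₖ (1 : Matrix (Fin 2) (Fin 2) ℝ)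

/-- The matrix `S_m = S ⊕ ⋯ ⊕ S`, with `S = [-i, -i; 1, -1]`. -/
noncomputable def diagS (m : ℕ) : Matrix (Fin m × Fin 2) (Fin m × Fin 2) ℂ :=
  (1 : Matrix (Fin m) (Fin m) ℂ) ⊗ₖ !![-Complex.I, -Complex.I; 1, -1]

/-- The permutation matrix `P_m = [e_1 e_3 ⋯ e_{2m-1} e_2 e_4 ⋯ e_{2m}]`. -/
def permP (m : ℕ) : Matrix (Fin m × Fin 2) (Fin m ⊕ Fin m) ℂ :=
  Matrix.of fun x y =>
    match y with
    | Sum.inl b => if x = (b, 0) then 1 else 0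
    | Sum.inr b => if x = (b, 1) then 1 else 0

/-- The matrix `F_{(j₁, j₂)} (C_m (z)) = S_m P_m (f_{j₁} (J_m (z)) ⊕ f_{j₂} (J_m (z̄))) P_mᵀ S_m⁻¹`. -/
noncomputable def branchRealBlock (p j₁ j₂ m : ℕ) (z : ℂ) :
    Matrix (Fin m × Fin 2) (Fin m × Fin 2) ℂ :=
  diagS m * permP m *
    Matrix.fromBlocks (branchBlock p j₁ m z) 0 0 (branchBlock p j₂ m (conj z)) *
    (permP m).transpose * (diagS m)⁻¹

/-- The sizes and eigenvalues of the diagonal blocks of a matrix in real Jordan form: `r` Jordan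
blocks with real eigenvalues and `c` blocks `C_m (z)`, one for each pair of complex Jordan blocks
with the nonreal eigenvalues `z`, `z̄`. -/
structure RealJordanData where
  /-- number of Jordan blocks with a real eigenvalue -/
  r : ℕ
  /-- number of conjugate pairs of Jordan blocks with a nonreal eigenvalue -/
  c : ℕ
  realSize : Fin r → ℕ
  realSize_pos : ∀ k, 0 < realSize k
  realEig : Fin r → ℝ
  cplxSize : Fin c → ℕ
  cplxSize_pos : ∀ k, 0 < cplxSize k
  cplxEig : Fin c → ℂ
  cplxEig_im : ∀ k, (cplxEig k).im ≠ 0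

namespace RealJordanData

/-- The index type of the rows and columns of the matrix in real Jordan form. -/
abbrev Idx (D : RealJordanData) : Type :=
  (Σ k : Fin D.r, Fin (D.realSize k)) ⊕ (Σ k : Fin D.c, Fin (D.cplxSize k) × Fin 2)

/-- The matrix `J_ℝ` in real Jordan form. -/
def matrix (D : RealJordanData) : Matrix D.Idx D.Idx ℝ :=
  Matrix.fromBlocks
    (Matrix.blockDiagonal' fun k => jordanBlock (D.realSize k) (D.realEig k)) 0
    0 (Matrix.blockDiagonal' fun k => realJordanBlock (D.cplxSize k) (D.cplxEig k))

/-- The Jordan blocks of the complex Jordan form: each real Jordan block, and for each block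
`C_m (z)` the two blocks `J_m (z)`, labelled `(k, 0)`, and `J_m (z̄)`, labelled `(k, 1)`. -/
abbrev Block (D : RealJordanData) : Type :=
  Fin D.r ⊕ (Fin D.c × Fin 2)

/-- The eigenvalue of a complex Jordan block. -/
noncomputable def eig (D : RealJordanData) : D.Block → ℂ
  | Sum.inl k => (D.realEig k : ℂ)
  | Sum.inr (k, u) => if u = 0 then D.cplxEig k else conj (D.cplxEig k)

/-- The number `t = r + 2 c` of blocks of the complex Jordan form. -/
def numBlocks (D : RealJordanData) : ℕ := D.r + 2 * D.c

/-- A branch choice takes the same branch on all blocks with the same eigenvalue. -/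
def Consistent (D : RealJordanData) {p : ℕ} (j : D.Block → Fin p) : Prop :=
  ∀ b b' : D.Block, D.eig b = D.eig b' → j b = j b'

/-- The matrix `⨁ f_{j_k} (J_{n_k} (λ_k)) ⊕ ⨁ F_{j_k} (C_{n_k} (λ_k))`, for a choice `j` of a branch
for each complex Jordan block; the pair `j_k = (j_{k_1}, j_{k_2})` of the `k`-th block `C_m (z)`
consists of the branches for `J_m (z)` and `J_m (z̄)`. -/
noncomputable def branchMatrix (D : RealJordanData) {p : ℕ} (j : D.Block → Fin p) :
    Matrix D.Idx D.Idx ℂ :=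
  Matrix.fromBlocks
    (Matrix.blockDiagonal' fun k =>
      branchBlock p (j (Sum.inl k)) (D.realSize k) (D.realEig k)) 0
    0 (Matrix.blockDiagonal' fun k =>
      branchRealBlock p (j (Sum.inr (k, 0))) (j (Sum.inr (k, 1))) (D.cplxSize k) (D.cplxEig k))

end RealJordanData

/-- The complex matrix with the entries of a real matrix. -/
def toComplex {m n : Type*} (M : Matrix m n ℝ) : Matrix m n ℂ := M.map ((↑) : ℝ → ℂ)

/-- A real Jordan canonical form `R⁻¹ A R = J_ℝ` of a real matrix `A`, with a real invertible
matrix `R`, whose columns are indexed like those of `J_ℝ`. -/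
structure RealJordanForm {n : ℕ} (A : Matrix (Fin n) (Fin n) ℝ) extends RealJordanData where
  R : Matrix (Fin n) toRealJordanData.Idx ℝ
  Rinv : Matrix toRealJordanData.Idx (Fin n) ℝ
  mul_Rinv : R * Rinv = 1
  Rinv_mul : Rinv * R = 1
  Rinv_mul_mul : Rinv * A * R = toRealJordanData.matrix

namespace RealJordanForm

variable {n : ℕ} {A : Matrix (Fin n) (Fin n) ℝ}

/-- The matrix `X_j = R (⨁ f_{j_k} (J_{n_k}) ⊕ ⨁ F_{j_k} (C_{n_k})) R⁻¹`. -/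
noncomputable def root (D : RealJordanForm A) {p : ℕ} (j : D.Block → Fin p) :
    Matrix (Fin n) (Fin n) ℂ :=
  toComplex D.R * D.branchMatrix j * toComplex D.Rinv

/-- The matrix `X_j (U) = R U (⨁ f_{j_k} (J_{n_k}) ⊕ ⨁ F_{j_k} (C_{n_k})) U⁻¹ R⁻¹`. -/
noncomputable def rootConj (D : RealJordanForm A) {p : ℕ} (j : D.Block → Fin p)
    (U : Matrix D.Idx D.Idx ℂ) : Matrix (Fin n) (Fin n) ℂ :=
  toComplex D.R * U * D.branchMatrix j * U⁻¹ * toComplex D.Rinv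

end RealJordanForm

/-- `X` is a (complex) `p`-th root of the real matrix `A`. -/
def IsRoot {n : ℕ} (p : ℕ) (A : Matrix (Fin n) (Fin n) ℝ) (X : Matrix (Fin n) (Fin n) ℂ) : Prop :=
  X ^ p = toComplex A

/-- A primary root is one that is expressible as a (complex) polynomial in `A`. -/
def IsPrimaryRoot {n : ℕ} (p : ℕ) (A : Matrix (Fin n) (Fin n) ℝ)
    (X : Matrix (Fin n) (Fin n) ℂ) : Prop :=
  IsRoot p A X ∧ ∃ q : Polynomial ℂ, X = Polynomial.aeval (toComplex A) q

/-- A nonprimary root is one that is not expressible as a polynomial in `A`. -/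
def IsNonprimaryRoot {n : ℕ} (p : ℕ) (A : Matrix (Fin n) (Fin n) ℝ)
    (X : Matrix (Fin n) (Fin n) ℂ) : Prop :=
  IsRoot p A X ∧ ¬ ∃ q : Polynomial ℂ, X = Polynomial.aeval (toComplex A) q

/-- The number `s` of distinct (complex) eigenvalues of `A`. -/
noncomputable def numEig {n : ℕ} (A : Matrix (Fin n) (Fin n) ℝ) : ℕ :=
  (spectrum ℂ (toComplex A)).ncard

end MatrixRoots

/-!
The theorem is reduced to the complex Jordan form `J = ⨁ J_m (z)`: the matrices `S_m P_m` split
the blocks `C_m (z)` of `J_ℝ` into `J_m (z) ⊕ J_m (z̄)`, and they turn `branchMatrix` into the direct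
sum of the branches `f_j (J_m (z))` (`RealJordanData.exists_complex_form`).

An upper triangular Toeplitz matrix is the value of a power series at the nilpotent shift, and
`g ↦ g (shift)` is an algebra homomorphism (`toeplitz`) whose kernel is generated by `X ^ m`. The
block `J_m (z)` comes from `z + X`, and `f_j (J_m (z))` from a rescaled binomial series whose `p`-th
power is `z + X` (`branchSeries_pow`). A `p`-th root of `z + X` modulo `X ^ m` is determined by its
constant term, a `p`-th root of `z`; since only Toeplitz matrices commute with `J_m (z)`, the `p`-th
roots of a single nonsingular block are precisely its `p` branches
(`exists_branch_of_pow_eq_jordan`).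

*Primary roots.* A polynomial `q` in `J` acts on each block through the Taylor expansion of `q` at
the eigenvalue. If `q (J)` is a root, then the constant term `q (z)` fixes the branch on all blocks
with the eigenvalue `z`; conversely Hermite interpolation (`exists_polynomial_taylor`) realizes
every choice of branches that depends only on the eigenvalue. There are `p ^ s` such choices.

*All roots.* Let `X ^ p = J`. On a cyclic summand `ℂ[X] / (X - μ) ^ m` of the module defined by `X`,
the polynomial `X ^ p - μ ^ p` has a simple zero at `μ ≠ 0`, so its powers form a basis in which
`X ^ p` is a Jordan block (`exists_basis_of_cyclic`). So some basis makes `X` block diagonal and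
`X ^ p` a Jordan matrix (`exists_blockDiagonal`). By the uniqueness of the Jordan form
(`exists_equiv_of_jordanMatrix_similar`) its blocks are those of `J` up to order, and each block of
`X` is a branch. Hence `X` is conjugate to a sum of branches by a matrix that commutes with `J`
(`exists_conj_branchJordan`), and it is a polynomial in `J` precisely if the branches are consistent.

*The real Jordan form.* The blocks of a complex Jordan form of a real matrix come in conjugate pairs,
by uniqueness (`exists_conj_equiv`). Grouping them gives a real matrix `J_ℝ` similar over `ℂ` to the
given one, and real matrices similar over `ℂ` are similar over `ℝ` (`exists_real_similarity`).
-/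

/-! ### Toeplitz matrices and the Taylor series of the branches of the root -/

namespace MatrixRoots

open PowerSeries

/-- The upper triangular `m × m` Toeplitz matrix with the `d`-th coefficient of a power series on
the `d`-th superdiagonal. This is the value of the power series at the nilpotent shift matrix,
whence an algebra homomorphism. -/
noncomputable def toeplitz (m : ℕ) : ℂ⟦X⟧ →ₐ[ℂ] Matrix (Fin m) (Fin m) ℂ :=
  AlgHom.ofLinearMap
    { toFun := fun g => Matrix.of fun a b =>
        if (a : ℕ) ≤ b then coeff ((b : ℕ) - a) g else 0
      map_add' := fun g h => by
        ext a b
        simp only [Matrix.of_apply, Matrix.add_apply]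
        split_ifs <;> simp
      map_smul' := fun c g => by
        ext a b
        simp }
    (by
      ext a b
      simp only [LinearMap.coe_mk, AddHom.coe_mk, Matrix.of_apply, coeff_one, Matrix.one_apply,
        Fin.ext_iff]
      split_ifs <;> first | rfl | omega)
    (by
      intro g h
      ext a b
      simp only [LinearMap.coe_mk, AddHom.coe_mk, Matrix.of_apply, Matrix.mul_apply]
      rw [Fin.sum_univ_eq_sum_range (fun c => (if (a : ℕ) ≤ c then coeff (c - a) g else 0) *
        (if c ≤ (b : ℕ) then coeff ((b : ℕ) - c) h else 0)) m]
      -- only the terms `a ≤ c ≤ b` of the matrix product are nonzero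
      have hsub : Finset.Ico (a : ℕ) (b + 1) ⊆ Finset.range m := by
        intro c hc
        simp only [Finset.mem_Ico, Finset.mem_range] at hc ⊢
        omega
      rw [← Finset.sum_subset hsub]
      · split_ifs with hab
        · rw [coeff_mul, Finset.Nat.sum_antidiagonal_eq_sum_range_succ_mk,
            Finset.sum_Ico_eq_sum_range, Nat.sub_add_comm hab]
          refine Finset.sum_congr rfl fun k hk => ?_
          have hk' : k < b - a + 1 := by simpa using hk
          rw [if_pos (by omega), if_pos (by omega)]
          congr 3 <;> omega
        · rw [Finset.Ico_eq_empty (by omega), Finset.sum_empty]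
      · intro c _ hc
        simp only [Finset.mem_Ico, not_and, not_lt] at hc
        split_ifs with h1 h2
        · have := hc h1
          omega
        all_goals simp)

lemma toeplitz_apply (m : ℕ) (g : ℂ⟦X⟧) (a b : Fin m) :
    toeplitz m g a b = if (a : ℕ) ≤ b then coeff ((b : ℕ) - a) g else 0 := rfl

lemma toeplitz_X (m : ℕ) : toeplitz m X = shift ℂ m := by
  ext a b
  simp only [toeplitz_apply, coeff_X, shift, Matrix.of_apply]
  split_ifs <;> first | rfl | omega

lemma toeplitz_C (m : ℕ) (z : ℂ) : toeplitz m (C z) = Matrix.scalar (Fin m) z := by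
  ext a b
  simp only [toeplitz_apply, coeff_C, Matrix.scalar_apply, Matrix.diagonal_apply, Fin.ext_iff]
  split_ifs <;> first | rfl | omega

lemma toeplitz_eq_zero_iff {m : ℕ} {g : ℂ⟦X⟧} : toeplitz m g = 0 ↔ X ^ m ∣ g := by
  rw [X_pow_dvd_iff]
  constructor
  · intro h d hd
    have := congrFun (congrFun h ⟨0, by omega⟩) ⟨d, hd⟩
    simpa [toeplitz_apply] using this
  · intro h
    ext a b
    rw [toeplitz_apply]
    split_ifs
    · exact h _ (by omega)
    · rfl

lemma toeplitz_eq_iff {m : ℕ} {g h : ℂ⟦X⟧} : toeplitz m g = toeplitz m h ↔ X ^ m ∣ g - h := by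
  rw [← toeplitz_eq_zero_iff, map_sub, sub_eq_zero]

/-- The complex Jordan block of size `m` with eigenvalue `z`, the value at the shift matrix of the
power series `z + X`. -/
noncomputable def jordan (m : ℕ) (z : ℂ) : Matrix (Fin m) (Fin m) ℂ := toeplitz m (C z + X)

lemma jordan_eq (m : ℕ) (z : ℂ) : jordan m z = Matrix.scalar (Fin m) z + shift ℂ m := by
  rw [jordan, map_add, toeplitz_C, toeplitz_X]

/-- The value of a polynomial at the power series `z + X` is its Taylor expansion at `z`. -/
lemma aeval_C_add_X (z : ℂ) (q : Polynomial ℂ) :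
    Polynomial.aeval (C z + X : ℂ⟦X⟧) q = (Polynomial.taylor z q : Polynomial ℂ) := by
  have : Polynomial.aeval (C z + X : ℂ⟦X⟧) =
      (Polynomial.coeToPowerSeries.algHom ℂ).comp (Polynomial.taylorAlgHom z) := by
    ext1
    simp [Polynomial.coeToPowerSeries.algHom_apply, add_comm]
  rw [this]
  simp [Polynomial.coeToPowerSeries.algHom_apply]

/-- The Taylor series at `z` of the `j`-th branch of the `p`-th root function. -/
noncomputable def branchSeries (p j : ℕ) (z : ℂ) : ℂ⟦X⟧ :=
  mk fun d => branchDeriv p j d z / (Nat.factorial d : ℂ)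

lemma branchBlock_eq (p j m : ℕ) (z : ℂ) :
    branchBlock p j m z = toeplitz m (branchSeries p j z) := by
  ext a b
  simp [branchBlock, toeplitz_apply, branchSeries]

lemma branchDeriv_zero (p j : ℕ) (z : ℂ) :
    branchDeriv p j 0 z = ((‖z‖ ^ ((1 : ℝ) / p) : ℝ) : ℂ) *
      Complex.exp (Complex.I * (2 * Real.pi * j + Complex.arg z) / p) := by
  simp [branchDeriv]

lemma constantCoeff_branchSeries (p j : ℕ) (z : ℂ) :
    constantCoeff (branchSeries p j z) = branchDeriv p j 0 z := by
  rw [← coeff_zero_eq_constantCoeff_apply]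
  simp [branchSeries]

lemma branchDeriv_zero_pow {p : ℕ} (hp : p ≠ 0) (j : ℕ) (z : ℂ) :
    branchDeriv p j 0 z ^ p = z := by
  have hp' : (p : ℂ) ≠ 0 := by exact_mod_cast hp
  rw [branchDeriv_zero, mul_pow, ← Complex.ofReal_pow, ← Real.rpow_natCast, ← Real.rpow_mul
    (norm_nonneg z), one_div_mul_cancel (by exact_mod_cast hp), Real.rpow_one, ← Complex.exp_nat_mul]
  have : (p : ℂ) * (Complex.I * (2 * Real.pi * j + Complex.arg z) / p) =
      Complex.arg z * Complex.I + j * (2 * Real.pi * Complex.I) := by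
    field_simp
    ring
  rw [this, Complex.exp_add, Complex.exp_nat_mul_two_pi_mul_I, mul_one, Complex.norm_mul_exp_arg_mul_I]

lemma branchDeriv_zero_ne_zero (p j : ℕ) {z : ℂ} (hz : z ≠ 0) : branchDeriv p j 0 z ≠ 0 := by
  rw [branchDeriv_zero]
  refine mul_ne_zero ?_ (Complex.exp_ne_zero _)
  exact_mod_cast (Real.rpow_pos_of_pos (norm_pos_iff.2 hz) _).ne'

/-- The branches differ by powers of the primitive root of unity `exp (2 π i / p)`. -/
lemma branchDeriv_zero_eq_mul (p j : ℕ) (z : ℂ) :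
    branchDeriv p j 0 z = branchDeriv p 0 0 z * Complex.exp (2 * Real.pi * Complex.I / p) ^ j := by
  rw [branchDeriv_zero, branchDeriv_zero, ← Complex.exp_nat_mul,
    mul_assoc (((‖z‖ ^ ((1 : ℝ) / p) : ℝ) : ℂ)), ← Complex.exp_add]
  congr 2
  push_cast
  ring

lemma branchDeriv_zero_injective {p : ℕ} (hp : p ≠ 0) {z : ℂ} (hz : z ≠ 0) {j j' : Fin p}
    (h : branchDeriv p j 0 z = branchDeriv p j' 0 z) : j = j' := by
  rw [branchDeriv_zero_eq_mul p j, branchDeriv_zero_eq_mul p j'] at h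
  have h' := mul_left_cancel₀ (branchDeriv_zero_ne_zero p 0 hz) h
  exact Fin.ext ((Complex.isPrimitiveRoot_exp p hp).pow_inj j.2 j'.2 h')

lemma exists_branchDeriv_zero_eq {p : ℕ} (hp : p ≠ 0) {z w : ℂ} (hz : z ≠ 0) (h : w ^ p = z) :
    ∃ j : Fin p, branchDeriv p j 0 z = w := by
  have h0 := branchDeriv_zero_ne_zero p 0 hz
  have : NeZero p := ⟨hp⟩
  have h1 : (w / branchDeriv p 0 0 z) ^ p = 1 := by
    rw [div_pow, h, branchDeriv_zero_pow hp, div_self hz]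
  obtain ⟨i, hi, h2⟩ := (Complex.isPrimitiveRoot_exp p hp).eq_pow_of_pow_eq_one h1
  refine ⟨⟨i, hi⟩, ?_⟩
  rw [branchDeriv_zero_eq_mul, h2, mul_div_cancel₀ _ h0]

/-- The generalized binomial coefficient of `1 / p`, as it occurs in the derivatives of the
branches. -/
lemma choose_inv (p d : ℕ) (hp : p ≠ 0) : Ring.choose (1 / (p : ℂ)) d =
    1 / (p : ℂ) ^ d * (∏ i ∈ Finset.range d, (1 - (i : ℂ) * p)) / (Nat.factorial d : ℂ) := by
  have hp' : (p : ℂ) ≠ 0 := by exact_mod_cast hp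
  have hs : (descPochhammer ℤ d).smeval (1 / (p : ℂ)) =
      ∏ i ∈ Finset.range d, (1 / (p : ℂ) - i) := by
    rw [← descPochhammer_eval_eq_prod_range, ← descPochhammer_map (Int.castRingHom ℂ),
      Polynomial.eval_map, ← Polynomial.eval₂_smulOneHom_eq_smeval]
    congr 1
    exact RingHom.ext_int _ _
  rw [Ring.choose_eq_smul, hs, smul_eq_mul, mul_comm, ← div_eq_mul_inv]
  congr 1
  have : ∀ i ∈ Finset.range d, (1 / (p : ℂ) - i) = 1 / (p : ℂ) * (1 - i * p) := by
    intro i _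
    field_simp
  rw [Finset.prod_congr rfl this, Finset.prod_mul_distrib]
  simp

lemma branchDeriv_eq {p : ℕ} (hp : p ≠ 0) (j k : ℕ) {z : ℂ} (hz : z ≠ 0) :
    branchDeriv p j k z = 1 / (p : ℂ) ^ k * (∏ i ∈ Finset.range k, (1 - (i : ℂ) * p)) *
      (branchDeriv p j 0 z * z⁻¹ ^ k) := by
  have hp' : (p : ℂ) ≠ 0 := by exact_mod_cast hp
  have hn : 0 < ‖z‖ := norm_pos_iff.2 hz
  rw [branchDeriv_zero, branchDeriv]
  congr 1
  have e1 : (1 - (k : ℝ) * p) / p = 1 / p - k := by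
    field_simp
  have e2 : Complex.I * (2 * Real.pi * j + Complex.arg z * (1 - k * p)) / p =
      Complex.I * (2 * Real.pi * j + Complex.arg z) / p - k * (Complex.arg z * Complex.I) := by
    field_simp
    ring
  rw [e1, e2, Real.rpow_sub hn, Real.rpow_natCast, Complex.exp_sub, Complex.exp_nat_mul]
  have hz' : z ^ k = (‖z‖ : ℂ) ^ k * Complex.exp (Complex.arg z * Complex.I) ^ k := by
    rw [← mul_pow, Complex.norm_mul_exp_arg_mul_I]
  push_cast
  rw [inv_pow, hz', mul_inv]
  ring

/-- The Taylor series of a branch of the `p`-th root is a rescaled binomial series. -/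
lemma branchSeries_eq {p : ℕ} (hp : p ≠ 0) (j : ℕ) {z : ℂ} (hz : z ≠ 0) :
    branchSeries p j z =
      C (branchDeriv p j 0 z) * rescale z⁻¹ (PowerSeries.binomialSeries ℂ (1 / (p : ℂ))) := by
  ext d
  rw [branchSeries, coeff_mk, coeff_C_mul, coeff_rescale, binomialSeries_coeff, choose_inv p d hp,
    branchDeriv_eq hp j d hz, smul_eq_mul]
  ring

lemma binomialSeries_nsmul (r : ℂ) (k : ℕ) :
    PowerSeries.binomialSeries ℂ ((k : ℂ) * r) = PowerSeries.binomialSeries ℂ r ^ k := by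
  induction k with
  | zero => simp
  | succ k ih => rw [pow_succ, ← ih, ← binomialSeries_add]; push_cast; ring_nf

lemma branchSeries_pow {p : ℕ} (hp : p ≠ 0) (j : ℕ) {z : ℂ} (hz : z ≠ 0) :
    branchSeries p j z ^ p = C z + X := by
  have hp' : (p : ℂ) ≠ 0 := by exact_mod_cast hp
  have h1 : PowerSeries.binomialSeries ℂ (1 : ℂ) = 1 + X := by
    have := binomialSeries_nat (R := ℂ) (A := ℂ) 1
    simpa using this
  rw [branchSeries_eq hp j hz, mul_pow, ← map_pow, ← map_pow, branchDeriv_zero_pow hp,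
    ← binomialSeries_nsmul, mul_one_div_cancel hp', h1, map_add, map_one, rescale_X, mul_add,
    mul_one, ← mul_assoc, ← map_mul, mul_inv_cancel₀ hz, map_one, one_mul]

/-- Modulo `X ^ m`, a `p`-th root of a power series with nonzero constant term is determined by its
constant term. -/
lemma X_pow_dvd_sub_of_pow {p m : ℕ} (hp : p ≠ 0) {g h : ℂ⟦X⟧}
    (h0 : constantCoeff g = constantCoeff h) (hne : constantCoeff g ≠ 0)
    (hd : X ^ m ∣ g ^ p - h ^ p) : X ^ m ∣ g - h := by
  -- the cofactor of `g - h` in `g ^ p - h ^ p` has the constant term `p g₀ ^ (p - 1) ≠ 0`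
  have hu : IsUnit (∑ i ∈ Finset.range p, g ^ i * h ^ (p - 1 - i)) := by
    rw [PowerSeries.isUnit_iff_constantCoeff, isUnit_iff_ne_zero, map_sum]
    have : ∀ i ∈ Finset.range p, constantCoeff (g ^ i * h ^ (p - 1 - i)) =
        constantCoeff g ^ (p - 1) := by
      intro i hi
      have : i < p := by simpa using hi
      rw [map_mul, map_pow, map_pow, ← h0, ← pow_add]
      congr 1
      omega
    rw [Finset.sum_congr rfl this, Finset.sum_const, Finset.card_range, nsmul_eq_mul]
    exact mul_ne_zero (by exact_mod_cast hp) (pow_ne_zero _ hne)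
  rw [← Commute.geom_sum₂_mul (Commute.all g h)] at hd
  exact hu.dvd_mul_left.1 hd

lemma toeplitz_branchSeries_pow {p : ℕ} (hp : p ≠ 0) (j m : ℕ) {z : ℂ} (hz : z ≠ 0) :
    toeplitz m (branchSeries p j z) ^ p = jordan m z := by
  rw [← map_pow, branchSeries_pow hp j hz, jordan]

/-- A Toeplitz `p`-th root of a Jordan block is given by the branch that takes the constant
coefficient as its value. -/
lemma toeplitz_eq_branchSeries {p m : ℕ} (hp : p ≠ 0) {z : ℂ} (hz : z ≠ 0) {g : ℂ⟦X⟧} {j : ℕ}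
    (hg : toeplitz m g ^ p = jordan m z) (hj : branchDeriv p j 0 z = constantCoeff g) :
    toeplitz m g = toeplitz m (branchSeries p j z) := by
  rw [← toeplitz_branchSeries_pow hp j m hz, ← map_pow, ← map_pow, toeplitz_eq_iff] at hg
  rw [toeplitz_eq_iff]
  refine X_pow_dvd_sub_of_pow hp ?_ ?_ hg
  · rw [constantCoeff_branchSeries, hj]
  · rw [← hj]
    exact branchDeriv_zero_ne_zero p j hz

lemma constantCoeff_eq_of_toeplitz_eq {m : ℕ} (hm : 0 < m) {g h : ℂ⟦X⟧}
    (e : toeplitz m g = toeplitz m h) : constantCoeff g = constantCoeff h := by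
  have := congrFun (congrFun e ⟨0, hm⟩) ⟨0, hm⟩
  simpa [toeplitz_apply] using this

lemma constantCoeff_pow_of_toeplitz_pow {p m : ℕ} (hm : 0 < m) {z : ℂ} {g : ℂ⟦X⟧}
    (hg : toeplitz m g ^ p = jordan m z) : constantCoeff g ^ p = z := by
  rw [← map_pow, jordan] at hg
  simpa using constantCoeff_eq_of_toeplitz_eq hm hg

/-- Only Toeplitz matrices commute with a Jordan block, because a matrix in the commutant is
determined by its first row. -/
lemma exists_toeplitz_of_commute {m : ℕ} {z : ℂ} {Y : Matrix (Fin m) (Fin m) ℂ}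
    (h : Y * jordan m z = jordan m z * Y) : ∃ g : ℂ⟦X⟧, Y = toeplitz m g := by
  rcases Nat.eq_zero_or_pos m with rfl | hm
  · exact ⟨0, Subsingleton.elim _ _⟩
  have h' : Y * shift ℂ m = shift ℂ m * Y := by
    rw [jordan_eq, mul_add, add_mul, (Matrix.scalar_commute z (fun r' => Commute.all _ _) Y).eq] at h
    exact add_left_cancel h
  have hl : ∀ a b : Fin m, (Y * shift ℂ m) a b =
      if hb : 0 < (b : ℕ) then Y a ⟨b - 1, by omega⟩ else 0 := by
    intro a b
    simp only [Matrix.mul_apply, shift, Matrix.of_apply, mul_ite, mul_one, mul_zero]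
    split_ifs with hb
    · rw [Finset.sum_eq_single ⟨b - 1, by omega⟩]
      · rw [if_pos]
        simp only
        omega
      · intro c _ hc
        rw [if_neg]
        intro h
        exact hc (Fin.ext (by simp only; omega))
      · simp
    · exact Finset.sum_eq_zero fun c _ => if_neg (by omega)
  have hr : ∀ a b : Fin m, (shift ℂ m * Y) a b =
      if ha : (a : ℕ) + 1 < m then Y ⟨a + 1, ha⟩ b else 0 := by
    intro a b
    simp only [Matrix.mul_apply, shift, Matrix.of_apply, ite_mul, one_mul, zero_mul]
    split_ifs with ha
    · rw [Finset.sum_eq_single ⟨a + 1, ha⟩]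
      · simp
      · intro c _ hc
        rw [if_neg]
        intro h
        exact hc (Fin.ext h.symm)
      · simp
    · exact Finset.sum_eq_zero fun c _ => if_neg (by omega)
  refine ⟨mk fun d => if hd : d < m then Y ⟨0, hm⟩ ⟨d, hd⟩ else 0, ?_⟩
  -- comparing the entries of `Y N` and `N Y` shows that `Y` is constant along the diagonals
  have key : ∀ (a : ℕ) (ha : a < m) (b : Fin m), Y ⟨a, ha⟩ b =
      if a ≤ b then Y ⟨0, hm⟩ ⟨b - a, by omega⟩ else 0 := by
    intro a
    induction a with
    | zero => intro ha b; simp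
    | succ a ih =>
      intro ha b
      have e := congrFun (congrFun h' ⟨a, by omega⟩) b
      rw [hl, hr, dif_pos ha] at e
      rw [← e]
      split_ifs with h1 h2 h2
      · rw [ih, if_pos (by simp only; omega)]
        congr 2
        simp only
        omega
      · rw [ih, if_neg (by simp only; omega)]
      · omega
      · rfl
  ext a b
  rw [key a a.2 b, toeplitz_apply]
  split_ifs with hab
  · rw [coeff_mk, dif_pos]
  · rfl

/-- The `p`-th roots of a nonsingular Jordan block are its branches. -/
lemma exists_branch_of_pow_eq_jordan {p m : ℕ} (hp : p ≠ 0) (hm : 0 < m) {z : ℂ} (hz : z ≠ 0)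
    {Y : Matrix (Fin m) (Fin m) ℂ} (hY : Y ^ p = jordan m z) :
    ∃ j : Fin p, Y = toeplitz m (branchSeries p j z) := by
  obtain ⟨g, rfl⟩ := exists_toeplitz_of_commute (Y := Y) (z := z)
    (by rw [← hY, ← pow_succ, ← pow_succ'])
  obtain ⟨j, hj⟩ := exists_branchDeriv_zero_eq hp hz (constantCoeff_pow_of_toeplitz_pow hm hY)
  exact ⟨j, toeplitz_eq_branchSeries hp hz hY hj⟩

end MatrixRoots

/-! ### Cyclic modules over `ℂ[X]` -/

namespace MatrixRoots

open Polynomial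

/-- In a cyclic module over `ℂ[X]` whose generator `x` has annihilator `(X - μ) ^ m`, a polynomial
`f` with `f' (μ) ≠ 0` acts as a Jordan block of size `m` with eigenvalue `f (μ)`. Since
`g = f - f (μ)` has a simple zero at `μ`, the vectors `g ^ (m - 1) x, …, g x, x` are a basis. -/
lemma exists_basis_of_cyclic {M : Type*} [AddCommGroup M] [Module ℂ M] [Module ℂ[X] M]
    [IsScalarTower ℂ ℂ[X] M] (x : M) (μ : ℂ) (m : ℕ)
    (hx : ∀ q : ℂ[X], q • x = 0 ↔ (X - C μ) ^ m ∣ q) (hs : ∀ y : M, ∃ q : ℂ[X], y = q • x)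
    (f : ℂ[X]) (hf : f.derivative.eval μ ≠ 0) :
    ∃ b : Module.Basis (Fin m) ℂ M, ∀ i : Fin m, f • b i = f.eval μ • b i +
      if 0 < (i : ℕ) then b ⟨i - 1, by omega⟩ else 0 := by
  set g := f - C (f.eval μ) with hg
  obtain ⟨u, hu⟩ : (X - C μ) ∣ g := by
    rw [dvd_iff_isRoot]
    simp [hg]
  have hu0 : u.eval μ ≠ 0 := by
    have : g.derivative.eval μ = u.eval μ := by
      rw [hu]
      simp
    rw [← this, hg]
    simpa using hf
  have hcop : ∀ (k : ℕ) (q : ℂ[X]), q.eval μ ≠ 0 → IsCoprime ((X - C μ) ^ k) q := by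
    intro k q hq
    refine IsCoprime.pow_left ?_
    rw [(irreducible_X_sub_C μ).coprime_iff_not_dvd, dvd_iff_isRoot]
    exact hq
  have hCs : ∀ (c : ℂ) (y : M), (C c : ℂ[X]) • y = c • y := by
    intro c y
    rw [← algebraMap_eq, algebraMap_smul]
  have hli : LinearIndependent ℂ fun i : Fin m => (g ^ (m - 1 - (i : ℕ))) • x := by
    have hli' : LinearIndependent ℂ fun i : Fin m => (g ^ (i : ℕ)) • x := by
      rw [Fintype.linearIndependent_iff]
      intro c hc
      set F : ℂ[X] := ∑ i : Fin m, C (c i) * X ^ (i : ℕ) with hF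
      have hcF : ∀ i : Fin m, F.coeff i = c i := by
        intro i
        rw [hF, finsetSum_coeff, Finset.sum_eq_single i]
        · simp
        · intro j _ hj
          rw [coeff_C_mul_X_pow, if_neg]
          exact fun h => hj (Fin.ext h.symm)
        · simp
      have hcomp : (F.comp g) • x = 0 := by
        rw [← hc, hF, sum_comp, Finset.sum_smul]
        refine Finset.sum_congr rfl fun i _ => ?_
        rw [mul_comp, C_comp, pow_comp, X_comp, mul_smul, hCs]
      -- `F = X ^ r H` with `H (0) ≠ 0` gives `F (g) = (X - μ) ^ r` times a factor prime to `X - μ`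
      have hF0 : F = 0 := by
        by_contra hne
        obtain ⟨H, hH, hH0⟩ := exists_eq_pow_rootMultiplicity_mul_and_not_dvd F hne 0
        rw [map_zero, sub_zero] at hH hH0
        set r := F.rootMultiplicity 0
        rw [hx, hH, mul_comp, pow_comp, X_comp, hu, mul_pow, mul_assoc] at hcomp
        have h1 : (X - C μ) ^ m ∣ (X - C μ) ^ r := by
          refine (hcop m _ ?_).dvd_of_dvd_mul_right hcomp
          rw [eval_mul, eval_pow, eval_comp]
          refine mul_ne_zero (pow_ne_zero _ hu0) ?_
          rw [X_dvd_iff, coeff_zero_eq_eval_zero] at hH0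
          simpa using hH0
        have h2 : m ≤ r := by
          have := natDegree_le_of_dvd h1 (pow_ne_zero _ (X_sub_C_ne_zero μ))
          simpa using this
        have h3 : X ^ m ∣ F := (pow_dvd_pow X h2).trans ⟨H, hH⟩
        rw [X_pow_dvd_iff] at h3
        refine hne ?_
        rw [hF]
        refine Finset.sum_eq_zero fun i _ => ?_
        rw [← hcF, h3 i i.2]
        simp
      intro i
      rw [← hcF, hF0, coeff_zero]
    have := hli'.comp (Fin.rev : Fin m → Fin m) Fin.rev_injective
    convert this using 2 with i
    simp only [Function.comp, Fin.val_rev]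
    congr 2
    omega
  have hsurj : Function.Surjective
      ((LinearMap.toSpanSingleton ℂ[X] M x).restrictScalars ℂ ∘ₗ (degreeLT ℂ m).subtype) := by
    intro y
    obtain ⟨q, rfl⟩ := hs y
    have hmon : ((X - C μ) ^ m).Monic := (monic_X_sub_C μ).pow m
    refine ⟨⟨q %ₘ (X - C μ) ^ m, ?_⟩, ?_⟩
    · rw [mem_degreeLT]
      refine (degree_modByMonic_lt _ hmon).trans_eq ?_
      simp
    · simp only [LinearMap.comp_apply, Submodule.subtype_apply, LinearMap.restrictScalars_apply,
        LinearMap.toSpanSingleton_apply]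
      rw [← sub_eq_zero, ← sub_smul, hx]
      refine ⟨-(q /ₘ (X - C μ) ^ m), ?_⟩
      linear_combination modByMonic_add_div q ((X - C μ) ^ m)
  have : Module.Finite ℂ (degreeLT ℂ m) := Module.Finite.equiv (degreeLTEquiv ℂ m).symm
  have : Module.Finite ℂ M := Module.Finite.of_surjective _ hsurj
  have hfr : Module.finrank ℂ M = m := by
    refine le_antisymm ?_ ?_
    · refine (LinearMap.finrank_le_finrank_of_surjective hsurj).trans_eq ?_
      rw [(degreeLTEquiv ℂ m).finrank_eq]
      simp
    · simpa using hli.fintype_card_le_finrank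
  refine ⟨Module.Basis.mk hli (hli.span_eq_top_of_card_eq_finrank' (by simp [hfr])).ge, fun i => ?_⟩
  have hgf : f = g + C (f.eval μ) := by rw [hg]; ring
  simp only [Module.Basis.coe_mk]
  conv_lhs => rw [hgf]
  rw [add_smul, add_comm]
  congr 1
  · exact hCs _ _
  · rw [← mul_smul, ← pow_succ']
    split_ifs with hi
    · congr 2
      omega
    · rw [hx]
      have : m - 1 - (i : ℕ) + 1 = m := by omega
      rw [this, hu, mul_pow]
      exact dvd_mul_right _ _

end MatrixRoots

/-! ### Block diagonal form of a matrix with Jordan blocks for a polynomial in it -/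

namespace MatrixRoots

open Polynomial

lemma exists_isRoot_of_irreducible {P : ℂ[X]} (hP : Irreducible P) :
    ∃ μ : ℂ, Associated P (X - C μ) := by
  obtain ⟨μ, hμ⟩ := Complex.exists_root (degree_pos_of_irreducible hP)
  exact ⟨μ, ((irreducible_X_sub_C μ).associated_of_dvd hP (dvd_iff_isRoot.2 hμ)).symm⟩

/-- The form of `exists_basis_of_cyclic` for the summands in the structure theorem for modules over
`ℂ[X]`. -/
lemma exists_basis_of_quotient {P : ℂ[X]} (hP : Irreducible P) (e : ℕ) (f : ℂ[X])
    (hf : Function.Injective fun y : ℂ[X] ⧸ Submodule.span ℂ[X] {P ^ e} => f.derivative • y) :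
    ∃ (z : ℂ) (b : Module.Basis (Fin e) ℂ (ℂ[X] ⧸ Submodule.span ℂ[X] {P ^ e})),
      ∀ i : Fin e, f • b i = z • b i + if 0 < (i : ℕ) then b ⟨i - 1, by omega⟩ else 0 := by
  obtain rfl | he := Nat.eq_zero_or_pos e
  · have : Subsingleton (ℂ[X] ⧸ Submodule.span ℂ[X] {P ^ 0}) := by
      rw [Submodule.Quotient.subsingleton_iff, pow_zero]
      exact Ideal.span_singleton_one
    exact ⟨0, Module.Basis.empty _, fun i => i.elim0⟩
  obtain ⟨μ, hμ⟩ := exists_isRoot_of_irreducible hP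
  have hx : ∀ q : ℂ[X], q • (Submodule.Quotient.mk 1 : ℂ[X] ⧸ Submodule.span ℂ[X] {P ^ e}) = 0 ↔
      (X - C μ) ^ e ∣ q := by
    intro q
    rw [← Submodule.Quotient.mk_smul, Submodule.Quotient.mk_eq_zero, smul_eq_mul, mul_one,
      Submodule.mem_span_singleton, ← (hμ.pow_pow (n := e)).dvd_iff_dvd_left]
    constructor
    · rintro ⟨a, rfl⟩
      exact ⟨a, by rw [smul_eq_mul, mul_comm]⟩
    · rintro ⟨a, rfl⟩
      exact ⟨a, by rw [smul_eq_mul, mul_comm]⟩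
  refine ⟨f.eval μ, exists_basis_of_cyclic (Submodule.Quotient.mk 1) μ e hx ?_ f ?_⟩
  · intro y
    obtain ⟨q, rfl⟩ := Submodule.Quotient.mk_surjective _ y
    exact ⟨q, by rw [← Submodule.Quotient.mk_smul, smul_eq_mul, mul_one]⟩
  · intro h0
    have h1 : (X - C μ) ^ (e - 1) • (Submodule.Quotient.mk 1 : ℂ[X] ⧸ Submodule.span ℂ[X] {P ^ e})
        = 0 := by
      apply hf
      simp only [smul_zero]
      rw [← mul_smul, hx]
      obtain ⟨u, hu⟩ := dvd_iff_isRoot.2 h0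
      rw [hu]
      refine ⟨u, ?_⟩
      obtain ⟨e, rfl⟩ := Nat.exists_eq_add_of_lt he
      simp only [zero_add, Nat.add_sub_cancel]
      ring
    rw [hx] at h1
    have := natDegree_le_of_dvd h1 (pow_ne_zero _ (X_sub_C_ne_zero μ))
    simp at this
    omega

open Matrix in
/-- The matrix form of the structure theorem for modules over `ℂ[X]`: if `f' (A)` is invertible,
then a change of basis turns `A` into a block diagonal matrix on whose blocks `f (A)` is a Jordan
block. The choice `f = X` gives the Jordan form of `A`. -/
lemma exists_blockDiagonal {ι : Type*} [Fintype ι] [DecidableEq ι] (A : Matrix ι ι ℂ) (f : ℂ[X])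
    (hf : IsUnit (aeval A f.derivative)) :
    ∃ (β : Type) (_ : Fintype β) (_ : DecidableEq β) (m : β → ℕ) (eig : β → ℂ)
      (Y : ∀ b, Matrix (Fin (m b)) (Fin (m b)) ℂ)
      (W : Matrix ι (Σ b, Fin (m b)) ℂ) (W' : Matrix (Σ b, Fin (m b)) ι ℂ),
      W * W' = 1 ∧ W' * W = 1 ∧ A = W * blockDiagonal' Y * W' ∧
      (∀ b, 0 < m b) ∧ ∀ b, aeval (Y b) f = jordan (m b) (eig b) := by
  classical
  let φ : Module.End ℂ (ι → ℂ) := toLinAlgEquiv' A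
  obtain ⟨β, hβ, P, hP, e, ⟨E⟩⟩ := Module.equiv_directSum_of_isTorsion
    (Module.AEval.isTorsion_of_finiteDimensional ℂ (ι → ℂ) φ)
  let MM : β → Type := fun b => ℂ[X] ⧸ Submodule.span ℂ[X] {P b ^ e b}
  let E' : (ι → ℂ) ≃ₗ[ℂ] DirectSum β MM :=
    (Module.AEval.of ℂ (ι → ℂ) φ).trans (E.restrictScalars ℂ)
  have hE' : ∀ (q : ℂ[X]) (v : ι → ℂ), E' (aeval φ q v) = q • E' v := by
    intro q v
    exact E.map_smul q _
  have hinj : ∀ b, Function.Injective fun y : MM b => f.derivative • y := by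
    have h1 : Function.Injective (aeval φ f.derivative) := by
      have : IsUnit (aeval φ f.derivative) := by
        have := hf.map (toLinAlgEquiv' (R := ℂ) (n := ι))
        rwa [← aeval_algHom_apply (toLinAlgEquiv' (R := ℂ) (n := ι))] at this
      exact ((Module.End.isUnit_iff _).1 this).1
    have h2 : Function.Injective fun y : DirectSum β MM => f.derivative • y := by
      intro y y' h
      have : aeval φ f.derivative (E'.symm y) = aeval φ f.derivative (E'.symm y') := by
        apply E'.injective
        rw [hE', hE', E'.apply_symm_apply, E'.apply_symm_apply]
        exact h
      exact E'.symm.injective (h1 this)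
    intro b y y' h
    apply DirectSum.of_injective (β := MM) b
    apply h2
    have : ∀ y : MM b, f.derivative • DirectSum.of MM b y = DirectSum.of MM b (f.derivative • y) :=
      fun y => (DirectSum.of_smul (M := MM) ℂ[X] b f.derivative y).symm
    simp only [this]
    exact congrArg _ h
  have hb : ∀ b, ∃ (z : ℂ) (v : Module.Basis (Fin (e b)) ℂ (MM b)),
      ∀ i : Fin (e b), f • v i = z • v i + if 0 < (i : ℕ) then v ⟨i - 1, by omega⟩ else 0 :=
    fun b => exists_basis_of_quotient (hP b) (e b) f (hinj b)
  choose eig v hv using hb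
  let B₀ : Module.Basis (Σ b, Fin (e b)) ℂ (ι → ℂ) :=
    Module.Basis.map (M := DirectSum β MM) (DFinsupp.basis v) E'.symm
  -- the structure theorem allows trivial summands, with `e b = 0`; these are left out
  let σ : (Σ b : {b // 0 < e b}, Fin (e b)) ≃ Σ b, Fin (e b) :=
    Equiv.ofBijective (fun x => ⟨x.1.1, x.2⟩) (by
      constructor
      · rintro ⟨⟨b, hb⟩, i⟩ ⟨⟨b', hb'⟩, i'⟩ h
        simp only [Sigma.mk.injEq] at h
        obtain ⟨rfl, h⟩ := h
        obtain rfl := eq_of_heq h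
        rfl
      · rintro ⟨b, i⟩
        exact ⟨⟨⟨b, i.pos⟩, i⟩, rfl⟩)
  let B := B₀.reindex σ.symm
  let L : ∀ b, ℂ[X] →ₐ[ℂ] Module.End ℂ (MM b) := fun b => Algebra.lsmul ℂ ℂ (MM b)
  have hB : LinearMap.toMatrix B B φ = blockDiagonal' fun b : {b // 0 < e b} =>
      LinearMap.toMatrixAlgEquiv (v b) (L b X) := by
    have hrepr : ∀ (w : ι → ℂ) (b) (i : Fin (e b)), B₀.repr w ⟨b, i⟩ = (v b).repr (E' w b) i := by
      intro w b i
      rfl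
    have hE0 : ∀ (b) (i : Fin (e b)), E' (B₀ ⟨b, i⟩) = DirectSum.of MM b (v b i) := by
      intro b i
      refine DFinsupp.ext fun b' => ?_
      refine (v b').repr.injective (Finsupp.ext fun i' => ?_)
      rw [← hrepr, Module.Basis.repr_self]
      by_cases h : b = b'
      · subst h
        rw [DirectSum.of_eq_same, Module.Basis.repr_self, Finsupp.single_apply,
          Finsupp.single_apply]
        simp
      · rw [DirectSum.of_eq_of_ne _ _ _ (Ne.symm h), Finsupp.single_apply, if_neg]
        · simp
        · exact fun h' => h (congrArg Sigma.fst h')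
    ext ⟨b, i⟩ ⟨b', i'⟩
    rw [LinearMap.toMatrix_apply, Module.Basis.repr_reindex_apply, Module.Basis.reindex_apply,
      Equiv.symm_symm]
    change B₀.repr (φ (B₀ ⟨b', i'⟩)) ⟨b, i⟩ = _
    have h1 : φ (B₀ ⟨b', i'⟩) = aeval φ (X : ℂ[X]) (B₀ ⟨b', i'⟩) := by rw [aeval_X]
    rw [hrepr, h1, hE', hE0, ← DirectSum.of_smul (M := MM) ℂ[X]]
    by_cases h : b = b'
    · subst h
      rw [blockDiagonal'_apply_eq, DirectSum.of_eq_same]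
      rw [LinearMap.toMatrixAlgEquiv_apply]
      rfl
    · rw [blockDiagonal'_apply_ne _ _ _ h, DirectSum.of_eq_of_ne]
      · simp
      · exact fun h' => h (Subtype.ext h')
  refine ⟨{b // 0 < e b}, inferInstance, inferInstance, fun b => e b, fun b => eig b,
    fun b => LinearMap.toMatrixAlgEquiv (v b) (L b X), (Pi.basisFun ℂ ι).toMatrix B,
    B.toMatrix (Pi.basisFun ℂ ι), Module.Basis.toMatrix_mul_toMatrix_flip _ _,
    Module.Basis.toMatrix_mul_toMatrix_flip _ _, ?_, fun b => b.2, fun b => ?_⟩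
  · rw [← hB, basis_toMatrix_mul_linearMap_toMatrix_mul_basis_toMatrix,
      LinearMap.toMatrix_eq_toMatrix']
    exact (LinearMap.toMatrix'_toLin' A).symm
  · rw [aeval_algHom_apply, aeval_algHom_apply, aeval_X_left_apply]
    ext i i'
    rw [LinearMap.toMatrixAlgEquiv_apply]
    change (v b).repr (f • v b i') i = _
    rw [hv, jordan_eq, map_add, map_smul]
    simp only [Module.Basis.repr_self, Finsupp.add_apply, Finsupp.smul_apply, smul_eq_mul,
      Matrix.add_apply, scalar_apply, diagonal_apply, shift, of_apply, Finsupp.single_apply]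
    congr 1
    · simp [eq_comm]
    · split_ifs with h1 h2 h2
      · simp only [Module.Basis.repr_self, Finsupp.single_apply, Fin.ext_iff]
        rw [if_pos (by omega)]
      · simp only [Module.Basis.repr_self, Finsupp.single_apply, Fin.ext_iff]
        rw [if_neg (by omega)]
      · omega
      · simp

end MatrixRoots

/-! ### Uniqueness of the Jordan form -/

namespace MatrixRoots

open Matrix

section JordanMatrix

variable {β : Type*} [Fintype β] [DecidableEq β]

/-- The complex matrix in Jordan form with blocks of sizes `m b` and eigenvalues `eig b`. -/
noncomputable def jordanMatrix (m : β → ℕ) (eig : β → ℂ) :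
    Matrix (Σ b, Fin (m b)) (Σ b, Fin (m b)) ℂ :=
  blockDiagonal' fun b => jordan (m b) (eig b)

/-- The block diagonal matrix whose blocks are the Toeplitz matrices of a family of power series. -/
noncomputable def toeplitzMatrix (m : β → ℕ) :
    (β → PowerSeries ℂ) →ₐ[ℂ] Matrix (Σ b, Fin (m b)) (Σ b, Fin (m b)) ℂ :=
  { (blockDiagonal'RingHom (fun b => Fin (m b)) ℂ).comp
      (RingHom.pi fun b => (toeplitz (m b)).toRingHom.comp (Pi.evalRingHom _ b)) with
    commutes' := fun z => by
      change (blockDiagonal' fun b => toeplitz (m b) (PowerSeries.C z)) = _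
      simp only [toeplitz_C]
      exact blockDiagonal'_diagonal fun (b : β) (_ : Fin (m b)) => z }

lemma toeplitzMatrix_apply (m : β → ℕ) (g : β → PowerSeries ℂ) :
    toeplitzMatrix m g = blockDiagonal' fun b => toeplitz (m b) (g b) := rfl

lemma jordanMatrix_eq (m : β → ℕ) (eig : β → ℂ) :
    jordanMatrix m eig = toeplitzMatrix m fun b => PowerSeries.C (eig b) + PowerSeries.X := rfl

lemma blockDiagonal'_mulVec {m : β → ℕ} (M : ∀ b, Matrix (Fin (m b)) (Fin (m b)) ℂ)
    (w : (Σ b, Fin (m b)) → ℂ) (b : β) (i : Fin (m b)) :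
    (blockDiagonal' M *ᵥ w) ⟨b, i⟩ = (M b *ᵥ fun i => w ⟨b, i⟩) i := by
  simp only [mulVec, dotProduct, Fintype.sum_sigma]
  rw [Finset.sum_eq_single b]
  · simp only [blockDiagonal'_apply_eq]
  · intro c _ hc
    exact Finset.sum_eq_zero fun j _ => by rw [blockDiagonal'_apply_ne _ _ _ hc.symm, zero_mul]
  · simp

/-- The `k`-th power of the shift matrix moves the entries of a vector by `k` places. -/
lemma toeplitz_X_pow_mulVec {m : ℕ} (k : ℕ) (v : Fin m → ℂ) (i : Fin m) :
    (toeplitz m (PowerSeries.X ^ k) *ᵥ v) i = if h : (i : ℕ) + k < m then v ⟨i + k, h⟩ else 0 := by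
  simp only [mulVec, dotProduct, toeplitz_apply, PowerSeries.coeff_X_pow]
  split_ifs with h
  · rw [Finset.sum_eq_single ⟨i + k, h⟩]
    · simp
    · intro j _ hj
      have : (j : ℕ) ≠ i + k := fun h => hj (Fin.ext h)
      split_ifs
      · omega
      · simp
      · simp
    · simp
  · refine Finset.sum_eq_zero fun j _ => ?_
    split_ifs
    · omega
    · simp
    · simp

/-- The kernel of `(J - z) ^ k` is spanned by the first `k` basis vectors of each block with
eigenvalue `z`. -/
lemma jordanMatrix_sub_pow_mulVec_eq_zero_iff (m : β → ℕ) (eig : β → ℂ) (z : ℂ) (k : ℕ)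
    (w : (Σ b, Fin (m b)) → ℂ) :
    ((jordanMatrix m eig - scalar _ z) ^ k) *ᵥ w = 0 ↔
      ∀ x, ¬ (eig x.1 = z ∧ (x.2 : ℕ) < k) → w x = 0 := by
  have hJ : (jordanMatrix m eig - scalar _ z) ^ k =
      blockDiagonal' fun b => toeplitz (m b)
        ((PowerSeries.C (eig b - z) + PowerSeries.X) ^ k) := by
    have hs : scalar (Σ b, Fin (m b)) z = toeplitzMatrix m fun _ => PowerSeries.C z :=
      ((toeplitzMatrix m).commutes z).symm
    rw [hs, jordanMatrix_eq, ← map_sub, ← map_pow, toeplitzMatrix_apply]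
    congr 1
    funext b
    simp only [Pi.pow_apply, Pi.sub_apply, map_sub]
    congr 2
    ring
  rw [hJ]
  constructor
  · intro h x hx
    obtain ⟨b, i⟩ := x
    have hb : toeplitz (m b) ((PowerSeries.C (eig b - z) + PowerSeries.X) ^ k) *ᵥ
        (fun i => w ⟨b, i⟩) = 0 := by
      funext i
      rw [← blockDiagonal'_mulVec
        (fun b => toeplitz (m b) ((PowerSeries.C (eig b - z) + PowerSeries.X) ^ k)), h]
      rfl
    by_cases he : eig b = z
    · have hi : k ≤ i := by
        simp only [not_and, not_lt] at hx
        exact hx he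
      have := congrFun hb ⟨i - k, by omega⟩
      rw [he, sub_self, map_zero, zero_add, toeplitz_X_pow_mulVec, dif_pos (by simp only; omega)]
        at this
      rw [Pi.zero_apply] at this
      rw [← this]
      congr 2
      exact Fin.ext (by simp only; omega)
    · have hu : IsUnit (toeplitz (m b) ((PowerSeries.C (eig b - z) + PowerSeries.X) ^ k)) := by
        refine IsUnit.map _ (IsUnit.pow _ ?_)
        rw [PowerSeries.isUnit_iff_constantCoeff, isUnit_iff_ne_zero]
        simpa [sub_eq_zero] using he
      have := mulVec_injective_of_isUnit hu (hb.trans (mulVec_zero _).symm)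
      exact congrFun this i
  · intro h
    funext ⟨b, i⟩
    rw [blockDiagonal'_mulVec]
    by_cases he : eig b = z
    · rw [he, sub_self, map_zero, zero_add, toeplitz_X_pow_mulVec]
      split_ifs with hi
      · exact h _ fun h' => by simp at h'
      · rfl
    · have : (fun i => w ⟨b, i⟩) = 0 := funext fun i => h _ fun h' => he h'.1
      rw [this, mulVec_zero]
      rfl

open Classical in
lemma finrank_ker_jordanMatrix (m : β → ℕ) (eig : β → ℂ) (z : ℂ) (k : ℕ) :
    Module.finrank ℂ (LinearMap.ker ((jordanMatrix m eig - scalar _ z) ^ k).mulVecLin) =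
      Fintype.card {x : Σ b, Fin (m b) // eig x.1 = z ∧ (x.2 : ℕ) < k} := by
  set K := LinearMap.ker ((jordanMatrix m eig - scalar _ z) ^ k).mulVecLin with hK
  have hmem : ∀ w, w ∈ K ↔ ∀ x, ¬ (eig x.1 = z ∧ (x.2 : ℕ) < k) → w x = 0 := by
    intro w
    rw [hK, LinearMap.mem_ker, mulVecLin_apply, jordanMatrix_sub_pow_mulVec_eq_zero_iff]
  let r : K →ₗ[ℂ] ({x : Σ b, Fin (m b) // eig x.1 = z ∧ (x.2 : ℕ) < k} → ℂ) :=
    (LinearMap.funLeft ℂ ℂ Subtype.val).comp K.subtype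
  have hr : Function.Bijective r := by
    constructor
    · rintro ⟨w, hw⟩ ⟨w', hw'⟩ h
      rw [hmem] at hw hw'
      ext x
      by_cases hx : eig x.1 = z ∧ (x.2 : ℕ) < k
      · exact congrFun h ⟨x, hx⟩
      · simp only
        rw [hw x hx, hw' x hx]
    · intro u
      refine ⟨⟨fun x => if hx : eig x.1 = z ∧ (x.2 : ℕ) < k then u ⟨x, hx⟩ else 0, ?_⟩, ?_⟩
      · rw [hmem]
        intro x hx
        rw [dif_neg hx]
      · funext x
        exact dif_pos x.2
  rw [(LinearEquiv.ofBijective r hr).finrank_eq, Module.finrank_fintype_fun_eq_card]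

end JordanMatrix

lemma rank_conj_eq {ι κ : Type*} [Fintype ι] [DecidableEq ι] [Fintype κ] [DecidableEq κ]
    {W : Matrix ι κ ℂ} {W' : Matrix κ ι ℂ} (h' : W' * W = 1) (M : Matrix κ κ ℂ) :
    (W * M * W').rank = M.rank := by
  refine le_antisymm ((rank_mul_le_left _ _).trans (rank_mul_le_right _ _)) ?_
  have : M = W' * (W * M * W') * W := by
    simp only [← Matrix.mul_assoc, h', Matrix.one_mul]
    rw [Matrix.mul_assoc, h', Matrix.mul_one]
  conv_lhs => rw [this]
  exact (rank_mul_le_left _ _).trans (rank_mul_le_right _ _)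

/-- Conjugation by an invertible rectangular matrix `W` with inverse `W'`. -/
def conjAlgEquiv {ι κ : Type*} [Fintype ι] [DecidableEq ι] [Fintype κ] [DecidableEq κ]
    (W : Matrix ι κ ℂ) (W' : Matrix κ ι ℂ) (h : W * W' = 1) (h' : W' * W = 1) :
    Matrix κ κ ℂ ≃ₐ[ℂ] Matrix ι ι ℂ :=
  AlgEquiv.ofLinearEquiv
    { toFun := fun M => W * M * W'
      invFun := fun M => W' * M * W
      map_add' := fun M N => by rw [Matrix.mul_add, Matrix.add_mul]
      map_smul' := fun c M => by simp
      left_inv := fun M => by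
        simp only [← Matrix.mul_assoc, h', Matrix.one_mul]
        rw [Matrix.mul_assoc, h', Matrix.mul_one]
      right_inv := fun M => by
        simp only [← Matrix.mul_assoc, h, Matrix.one_mul]
        rw [Matrix.mul_assoc, h, Matrix.mul_one] }
    (by
      change W * (1 : Matrix κ κ ℂ) * W' = 1
      rw [Matrix.mul_one, h])
    (fun M N => by
      change W * (M * N) * W' = W * M * W' * (W * N * W')
      have : W' * (W * (N * W')) = N * W' := by rw [← Matrix.mul_assoc, h', Matrix.one_mul]
      simp only [Matrix.mul_assoc, this])

lemma conjAlgEquiv_apply {ι κ : Type*} [Fintype ι] [DecidableEq ι] [Fintype κ] [DecidableEq κ]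
    (W : Matrix ι κ ℂ) (W' : Matrix κ ι ℂ) (h : W * W' = 1) (h' : W' * W = 1) (M : Matrix κ κ ℂ) :
    conjAlgEquiv W W' h h' M = W * M * W' := rfl

lemma card_eq_of_mul_eq_one {ι κ : Type*} [Fintype ι] [DecidableEq ι] [Fintype κ] [DecidableEq κ]
    {W : Matrix ι κ ℂ} {W' : Matrix κ ι ℂ} (h : W * W' = 1) (h' : W' * W = 1) :
    Fintype.card ι = Fintype.card κ := by
  have := rank_conj_eq h' (1 : Matrix κ κ ℂ)
  rwa [Matrix.mul_one, h, rank_one, rank_one] at this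

/-- Renumbering rows and columns is a conjugation by a permutation matrix. -/
lemma exists_submatrix_eq_conj {ι κ : Type*} [Fintype ι] [DecidableEq ι] [Fintype κ]
    [DecidableEq κ] (e : ι ≃ κ) :
    ∃ (P : Matrix ι κ ℂ) (P' : Matrix κ ι ℂ), P * P' = 1 ∧ P' * P = 1 ∧
      ∀ M : Matrix κ κ ℂ, M.submatrix e e = P * M * P' := by
  let E : Matrix κ κ ℂ := 1
  refine ⟨E.submatrix e id, E.submatrix id e, ?_, ?_, fun M => ?_⟩
  · rw [← submatrix_mul _ _ _ _ _ Function.bijective_id, Matrix.one_mul]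
    exact submatrix_one_equiv e
  · rw [← submatrix_mul _ _ _ _ _ e.bijective, Matrix.one_mul, submatrix_id_id]
  · ext x y
    simp [E, Matrix.mul_apply, Matrix.one_apply]

open Classical in
/-- The dimensions of the kernels of `(J - z) ^ (k + 1)` and `(J - z) ^ k` differ by the number of
blocks with eigenvalue `z` of size greater than `k`. -/
lemma card_lt_succ {β : Type*} [Fintype β] (m : β → ℕ) (eig : β → ℂ) (z : ℂ) (k : ℕ) :
    Fintype.card {x : Σ b, Fin (m b) // eig x.1 = z ∧ (x.2 : ℕ) < k + 1} =
      Fintype.card {x : Σ b, Fin (m b) // eig x.1 = z ∧ (x.2 : ℕ) < k} +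
        Fintype.card {b : β // eig b = z ∧ k < m b} := by
  let F : {b : β // eig b = z ∧ k < m b} → {x : Σ b, Fin (m b) // eig x.1 = z ∧ (x.2 : ℕ) = k} :=
    fun b => ⟨⟨b.1, ⟨k, b.2.2⟩⟩, b.2.1, rfl⟩
  have hF : Function.Bijective F := by
    constructor
    · intro b b' h
      exact Subtype.ext (congrArg (fun x => x.1.1) h)
    · rintro ⟨⟨b, i, hi⟩, rfl, h2⟩
      simp only at h2
      subst h2
      exact ⟨⟨b, rfl, hi⟩, rfl⟩
  rw [Fintype.card_of_bijective hF, ← Fintype.card_subtype_or_disjoint]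
  · refine Fintype.card_congr (Equiv.subtypeEquivRight fun x => ?_)
    rw [← and_or_left, Nat.lt_succ_iff_lt_or_eq]
  · rw [Pi.disjoint_iff]
    intro x
    rw [Prop.disjoint_iff]
    rintro ⟨⟨-, h1⟩, -, h2⟩
    omega

open Classical in
lemma card_size_eq {β : Type*} [Fintype β] (m : β → ℕ) (eig : β → ℂ) (z : ℂ) (k : ℕ) :
    Fintype.card {b : β // eig b = z ∧ k < m b} =
      Fintype.card {b : β // eig b = z ∧ k + 1 < m b} +
        Fintype.card {b : β // eig b = z ∧ m b = k + 1} := by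
  rw [← Fintype.card_subtype_or_disjoint]
  · refine Fintype.card_congr (Equiv.subtypeEquivRight fun x => ?_)
    rw [← and_or_left]
    refine and_congr_right fun _ => ?_
    omega
  · rw [Pi.disjoint_iff]
    intro x
    rw [Prop.disjoint_iff]
    rintro ⟨⟨-, h1⟩, -, h2⟩
    omega

section Uniqueness

variable {β β' : Type*} [Fintype β] [DecidableEq β] [Fintype β'] [DecidableEq β']

/-- Uniqueness of the Jordan form: similar Jordan matrices have the same blocks, up to order. The
number of blocks with eigenvalue `z` and size `k` is a second difference of the dimensions of the
kernels of `(J - z) ^ k`. -/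
lemma exists_equiv_of_jordanMatrix_similar {m : β → ℕ} {eig : β → ℂ} {m' : β' → ℕ}
    {eig' : β' → ℂ} (hm : ∀ b, 0 < m b) (hm' : ∀ b, 0 < m' b)
    (W : Matrix (Σ b, Fin (m b)) (Σ b, Fin (m' b)) ℂ)
    (W' : Matrix (Σ b, Fin (m' b)) (Σ b, Fin (m b)) ℂ) (h : W * W' = 1) (h' : W' * W = 1)
    (hJ : jordanMatrix m eig = W * jordanMatrix m' eig' * W') :
    ∃ σ : β ≃ β', (∀ b, m' (σ b) = m b) ∧ ∀ b, eig' (σ b) = eig b := by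
  classical
  have hcard := card_eq_of_mul_eq_one h h'
  have hker : ∀ (z : ℂ) (k : ℕ),
      Fintype.card {x : Σ b, Fin (m b) // eig x.1 = z ∧ (x.2 : ℕ) < k} =
      Fintype.card {x : Σ b, Fin (m' b) // eig' x.1 = z ∧ (x.2 : ℕ) < k} := by
    intro z k
    have hr : ((jordanMatrix m eig - scalar _ z) ^ k).rank =
        ((jordanMatrix m' eig' - scalar _ z) ^ k).rank := by
      rw [← rank_conj_eq h' ((jordanMatrix m' eig' - scalar _ z) ^ k)]
      congr 1
      have := map_pow (conjAlgEquiv W W' h h') (jordanMatrix m' eig' - scalar _ z) k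
      rw [map_sub, conjAlgEquiv_apply, conjAlgEquiv_apply, ← hJ] at this
      rw [this]
      congr 2
      exact ((conjAlgEquiv W W' h h').commutes z).symm
    have h1 := LinearMap.finrank_range_add_finrank_ker
      ((jordanMatrix m eig - scalar _ z) ^ k).mulVecLin
    have h2 := LinearMap.finrank_range_add_finrank_ker
      ((jordanMatrix m' eig' - scalar _ z) ^ k).mulVecLin
    rw [finrank_ker_jordanMatrix, Module.finrank_fintype_fun_eq_card] at h1 h2
    change Matrix.rank _ + _ = _ at h1 h2
    omega
  have hgt : ∀ (z : ℂ) (k : ℕ), Fintype.card {b : β // eig b = z ∧ k < m b} =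
      Fintype.card {b : β' // eig' b = z ∧ k < m' b} := by
    intro z k
    have h1 := card_lt_succ m eig z k
    have h2 := card_lt_succ m' eig' z k
    rw [hker, hker] at h1
    omega
  have heq : ∀ (z : ℂ) (k : ℕ), Fintype.card {b : β // eig b = z ∧ m b = k + 1} =
      Fintype.card {b : β' // eig' b = z ∧ m' b = k + 1} := by
    intro z k
    have h1 := card_size_eq m eig z k
    have h2 := card_size_eq m' eig' z k
    rw [hgt, hgt] at h1
    omega
  have hfib : ∀ c : ℂ × ℕ, Nonempty ({b : β // (eig b, m b) = c} ≃ {b : β' // (eig' b, m' b) = c}) := by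
    rintro ⟨z, k⟩
    rw [← Fintype.card_eq]
    rcases k with _ | k
    -- there are no blocks of size zero
    · have : IsEmpty {b : β // (eig b, m b) = (z, 0)} :=
        ⟨fun b => (hm b).ne' (Prod.ext_iff.1 b.2).2⟩
      have : IsEmpty {b : β' // (eig' b, m' b) = (z, 0)} :=
        ⟨fun b => (hm' b).ne' (Prod.ext_iff.1 b.2).2⟩
      rw [Fintype.card_eq_zero, Fintype.card_eq_zero]
    · simpa only [Prod.mk.injEq] using heq z k
  let σ := Equiv.ofFiberEquiv fun c => (hfib c).some
  have hσ : ∀ b, (eig' (σ b), m' (σ b)) = (eig b, m b) := fun b =>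
    Equiv.ofFiberEquiv_map (fun c => (hfib c).some) b
  exact ⟨σ, fun b => (Prod.ext_iff.1 (hσ b)).2, fun b => (Prod.ext_iff.1 (hσ b)).1⟩

end Uniqueness

end MatrixRoots

/-! ### Roots of a complex Jordan matrix -/

namespace MatrixRoots

open Matrix

section

variable {β : Type*} [Fintype β] [DecidableEq β]

/-- A polynomial in a Jordan matrix is given on each block by the Taylor expansion of the polynomial
at the eigenvalue. -/
lemma aeval_jordanMatrix (m : β → ℕ) (eig : β → ℂ) (q : Polynomial ℂ) :
    Polynomial.aeval (jordanMatrix m eig) q =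
      toeplitzMatrix m fun b => (Polynomial.taylor (eig b) q : Polynomial ℂ) := by
  rw [jordanMatrix_eq, Polynomial.aeval_algHom_apply]
  congr 1
  funext b
  rw [← aeval_C_add_X]
  exact (Polynomial.aeval_algHom_apply (Pi.evalAlgHom ℂ (fun _ : β => PowerSeries ℂ) b) _ q).symm

/-- The root of a complex Jordan matrix given by the choice `j` of a branch for each block. -/
noncomputable def branchJordan {p : ℕ} (m : β → ℕ) (eig : β → ℂ) (j : β → Fin p) :
    Matrix (Σ b, Fin (m b)) (Σ b, Fin (m b)) ℂ :=
  toeplitzMatrix m fun b => branchSeries p (j b) (eig b)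

lemma branchJordan_pow {p : ℕ} (hp : p ≠ 0) (m : β → ℕ) {eig : β → ℂ} (he : ∀ b, eig b ≠ 0)
    (j : β → Fin p) : branchJordan m eig j ^ p = jordanMatrix m eig := by
  rw [branchJordan, ← map_pow, jordanMatrix_eq]
  congr 1
  funext b
  exact branchSeries_pow hp _ (he b)

lemma toeplitz_eq_of_toeplitzMatrix_eq {m : β → ℕ} {g h : β → PowerSeries ℂ}
    (e : toeplitzMatrix m g = toeplitzMatrix m h) (b : β) :
    toeplitz (m b) (g b) = toeplitz (m b) (h b) :=
  congrFun (blockDiagonal'_injective e) b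

lemma constantCoeff_eq_of_toeplitzMatrix_eq {m : β → ℕ} (hm : ∀ b, 0 < m b)
    {g h : β → PowerSeries ℂ} (e : toeplitzMatrix m g = toeplitzMatrix m h) (b : β) :
    PowerSeries.constantCoeff (g b) = PowerSeries.constantCoeff (h b) :=
  constantCoeff_eq_of_toeplitz_eq (hm b) (toeplitz_eq_of_toeplitzMatrix_eq e b)

lemma branchJordan_injective {p : ℕ} (hp : p ≠ 0) {m : β → ℕ} (hm : ∀ b, 0 < m b) {eig : β → ℂ}
    (he : ∀ b, eig b ≠ 0) :
    Function.Injective (branchJordan m eig : (β → Fin p) → _) := by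
  intro j j' h
  funext b
  have := constantCoeff_eq_of_toeplitzMatrix_eq hm h b
  rw [constantCoeff_branchSeries, constantCoeff_branchSeries] at this
  exact branchDeriv_zero_injective hp (he b) this

lemma constantCoeff_taylor (z : ℂ) (q : Polynomial ℂ) :
    PowerSeries.constantCoeff (Polynomial.taylor z q : PowerSeries ℂ) = q.eval z := by
  rw [← PowerSeries.coeff_zero_eq_constantCoeff_apply, Polynomial.coeff_coe,
    Polynomial.taylor_coeff_zero]

/-- If `branchJordan` is a polynomial in the Jordan matrix, then the branches agree on blocks with
the same eigenvalue `z`, because the polynomial has only one value at `z`. -/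
lemma consistent_of_branchJordan_eq_aeval {p : ℕ} (hp : p ≠ 0) {m : β → ℕ} (hm : ∀ b, 0 < m b)
    {eig : β → ℂ} (he : ∀ b, eig b ≠ 0) {j : β → Fin p} {q : Polynomial ℂ}
    (h : branchJordan m eig j = Polynomial.aeval (jordanMatrix m eig) q) (b b' : β)
    (hb : eig b = eig b') : j b = j b' := by
  rw [aeval_jordanMatrix] at h
  have h1 := constantCoeff_eq_of_toeplitzMatrix_eq hm h
  simp only [constantCoeff_branchSeries, constantCoeff_taylor] at h1
  refine branchDeriv_zero_injective hp (he b) ?_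
  rw [h1 b, hb, h1 b']

/-- A root that is a polynomial `q` in the Jordan matrix is given on a block with eigenvalue `z` by
the branch with the value `q (z)`. -/
lemma exists_branchJordan_of_aeval {p : ℕ} (hp : p ≠ 0) {m : β → ℕ} (hm : ∀ b, 0 < m b)
    {eig : β → ℂ} (he : ∀ b, eig b ≠ 0) {q : Polynomial ℂ}
    (h : Polynomial.aeval (jordanMatrix m eig) q ^ p = jordanMatrix m eig) :
    ∃ j : β → Fin p, Polynomial.aeval (jordanMatrix m eig) q = branchJordan m eig j := by
  rw [aeval_jordanMatrix, ← map_pow, jordanMatrix_eq] at h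
  have h1 := toeplitz_eq_of_toeplitzMatrix_eq h
  simp only [Pi.pow_apply, map_pow] at h1
  have h2 : ∀ b, ∃ j : Fin p, branchDeriv p j 0 (eig b) = q.eval (eig b) := by
    intro b
    refine exists_branchDeriv_zero_eq hp (he b) ?_
    rw [← constantCoeff_taylor]
    exact constantCoeff_pow_of_toeplitz_pow (hm b) (h1 b)
  choose j hj using h2
  refine ⟨j, ?_⟩
  rw [aeval_jordanMatrix, branchJordan, toeplitzMatrix_apply, toeplitzMatrix_apply]
  congr 1
  funext b
  refine toeplitz_eq_branchSeries hp (he b) (h1 b) ?_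
  rw [constantCoeff_taylor, hj]

/-- Hermite interpolation, by the Chinese remainder theorem: a polynomial has prescribed Taylor
expansions at finitely many points up to a given order. -/
lemma exists_polynomial_taylor {κ : Type*} [Finite κ] (z : κ → ℂ) (hz : Function.Injective z)
    (g : κ → PowerSeries ℂ) (N : ℕ) :
    ∃ q : Polynomial ℂ, ∀ k, PowerSeries.X ^ N ∣ (Polynomial.taylor (z k) q : PowerSeries ℂ) - g k := by
  classical
  obtain ⟨q, hq⟩ := Ideal.exists_forall_sub_mem_ideal
    (I := fun k => Ideal.span {(Polynomial.X - Polynomial.C (z k)) ^ N})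
    (fun k k' hk => by
      rw [Function.onFun, Ideal.isCoprime_span_singleton_iff]
      refine IsCoprime.pow ?_
      exact Polynomial.pairwise_coprime_X_sub_C hz hk)
    fun k => Polynomial.taylor (-z k) (PowerSeries.trunc N (g k))
  refine ⟨q, fun k => ?_⟩
  obtain ⟨u, hu⟩ := Ideal.mem_span_singleton.1 (hq k)
  have h1 : Polynomial.taylor (z k) q = PowerSeries.trunc N (g k) +
      Polynomial.X ^ N * Polynomial.taylor (z k) u := by
    have := congrArg (Polynomial.taylor (z k)) hu
    rw [map_sub, Polynomial.taylor_taylor, Polynomial.taylor_mul, Polynomial.taylor_pow] at this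
    simp at this
    rw [← this]
    ring
  rw [h1, PowerSeries.X_pow_dvd_iff]
  intro d hd
  rw [map_sub, Polynomial.coeff_coe, Polynomial.coeff_add, PowerSeries.coeff_trunc, if_pos hd,
    Polynomial.coeff_X_pow_mul', if_neg (by omega)]
  ring

/-- If the branches depend only on the eigenvalue, then interpolation at the eigenvalues gives a
polynomial that takes the Jordan matrix to `branchJordan`. -/
lemma exists_aeval_eq_branchJordan {p : ℕ} (m : β → ℕ) (eig : β → ℂ) {j : β → Fin p}
    (hj : ∀ b b', eig b = eig b' → j b = j b') :
    ∃ q : Polynomial ℂ, branchJordan m eig j = Polynomial.aeval (jordanMatrix m eig) q := by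
  have hrep : ∀ z : Set.range eig, ∃ b, eig b = z := fun z => z.2
  choose rep hrep using hrep
  -- the order `∑ b, m b` of interpolation is at least the size of each block
  obtain ⟨q, hq⟩ := exists_polynomial_taylor (fun z : Set.range eig => (z : ℂ))
    Subtype.val_injective (fun z => branchSeries p (j (rep z)) z) (∑ b, m b)
  refine ⟨q, ?_⟩
  rw [aeval_jordanMatrix, branchJordan, toeplitzMatrix_apply, toeplitzMatrix_apply]
  congr 1
  funext b
  symm
  rw [toeplitz_eq_iff]
  have h1 := hq ⟨eig b, b, rfl⟩
  rw [hj _ b (hrep ⟨eig b, b, rfl⟩)] at h1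
  exact (pow_dvd_pow _ (Finset.single_le_sum (fun _ _ => Nat.zero_le _) (Finset.mem_univ b))).trans h1

/-- Reordering the blocks is a conjugation. -/
lemma exists_perm_toeplitzMatrix {β' : Type*} [Fintype β'] [DecidableEq β'] {m : β → ℕ}
    {m' : β' → ℕ} (σ : β ≃ β') (hm : ∀ b, m' (σ b) = m b) :
    ∃ (P : Matrix (Σ b, Fin (m b)) (Σ b, Fin (m' b)) ℂ)
      (P' : Matrix (Σ b, Fin (m' b)) (Σ b, Fin (m b)) ℂ), P * P' = 1 ∧ P' * P = 1 ∧
      ∀ g : β' → PowerSeries ℂ,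
        toeplitzMatrix m (fun b => g (σ b)) = P * toeplitzMatrix m' g * P' := by
  obtain rfl : m = fun b => m' (σ b) := funext fun b => (hm b).symm
  let e : (Σ b, Fin (m' (σ b))) ≃ Σ b, Fin (m' b) :=
    Equiv.sigmaCongrLeft (β := fun b => Fin (m' b)) σ
  obtain ⟨P, P', h, h', hP⟩ := exists_submatrix_eq_conj e
  refine ⟨P, P', h, h', fun g => ?_⟩
  rw [← hP, toeplitzMatrix_apply, toeplitzMatrix_apply]
  ext ⟨b, i⟩ ⟨b', i'⟩
  rw [submatrix_apply]
  change _ = blockDiagonal' (fun b => toeplitz (m' b) (g b)) ⟨σ b, i⟩ ⟨σ b', i'⟩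
  by_cases h : b = b'
  · subst h
    rw [blockDiagonal'_apply_eq, blockDiagonal'_apply_eq]
  · rw [blockDiagonal'_apply_ne _ _ _ h, blockDiagonal'_apply_ne _ _ _ (σ.injective.ne h)]

/-- Every `p`-th root of a nonsingular Jordan matrix is similar to one given by a choice of
branches. In a basis adapted to the root `X`, both `X` and `X ^ p` are block diagonal, with Jordan
blocks for `X ^ p`; by uniqueness of the Jordan form these are the given ones up to order. -/
lemma exists_conj_branchJordan {p : ℕ} (hp : p ≠ 0) {m : β → ℕ} (hm : ∀ b, 0 < m b)
    {eig : β → ℂ} (he : ∀ b, eig b ≠ 0) {X : Matrix (Σ b, Fin (m b)) (Σ b, Fin (m b)) ℂ}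
    (hX : X ^ p = jordanMatrix m eig) :
    ∃ (j : β → Fin p) (U U' : Matrix (Σ b, Fin (m b)) (Σ b, Fin (m b)) ℂ),
      U * U' = 1 ∧ U' * U = 1 ∧ X = U * branchJordan m eig j * U' := by
  have hJ : IsUnit (jordanMatrix m eig) := by
    rw [jordanMatrix_eq]
    refine IsUnit.map _ (Pi.isUnit_iff.2 fun b => ?_)
    rw [PowerSeries.isUnit_iff_constantCoeff, isUnit_iff_ne_zero]
    simpa using he b
  have hXu : IsUnit X := (isUnit_pow_iff hp).1 (hX ▸ hJ)
  have hp' : (p : ℂ) ≠ 0 := by exact_mod_cast hp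
  obtain ⟨β', _, _, m', eig', Y, W, W', h, h', hW, hm', hY⟩ :=
    exists_blockDiagonal X (Polynomial.X ^ p) (by
      rw [Polynomial.derivative_X_pow, map_mul, map_pow, Polynomial.aeval_X, Polynomial.aeval_C]
      exact ((isUnit_iff_ne_zero.2 hp').map _).mul (hXu.pow _))
  simp only [map_pow, Polynomial.aeval_X] at hY
  have hJW : jordanMatrix m eig = W * jordanMatrix m' eig' * W' := by
    rw [← hX, hW, ← conjAlgEquiv_apply W W' h h', ← conjAlgEquiv_apply W W' h h', ← map_pow,
      ← blockDiagonal'_pow]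
    congr 2
    funext b
    exact hY b
  obtain ⟨σ, hσm, hσe⟩ := exists_equiv_of_jordanMatrix_similar hm hm' W W' h h' hJW
  have he' : ∀ b, eig' b ≠ 0 := by
    intro b
    obtain ⟨b, rfl⟩ := σ.surjective b
    rw [hσe]
    exact he b
  choose j hj using fun b => exists_branch_of_pow_eq_jordan hp (hm' b) (he' b) (hY b)
  obtain ⟨P, P', hP, hP', hPt⟩ := exists_perm_toeplitzMatrix σ hσm
  refine ⟨fun b => j (σ b), W * P', P * W', ?_, ?_, ?_⟩
  · rw [Matrix.mul_assoc, ← Matrix.mul_assoc P', hP', Matrix.one_mul, h]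
  · rw [Matrix.mul_assoc, ← Matrix.mul_assoc W', h', Matrix.one_mul, hP]
  · have h1 : blockDiagonal' Y = toeplitzMatrix m' fun b => branchSeries p (j b) (eig' b) := by
      rw [toeplitzMatrix_apply]
      congr 1
      exact funext hj
    have h2 : branchJordan m eig (fun b => j (σ b)) = P * blockDiagonal' Y * P' := by
      rw [h1, ← hPt, branchJordan]
      simp only [hσe]
    have h3 : P' * (P * blockDiagonal' Y * P') * P = blockDiagonal' Y := by
      simp only [← Matrix.mul_assoc, hP', Matrix.one_mul]
      rw [Matrix.mul_assoc, hP', Matrix.mul_one]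
    rw [h2, hW]
    conv_lhs => rw [← h3]
    simp only [Matrix.mul_assoc]

lemma spectrum_jordanMatrix {m : β → ℕ} (hm : ∀ b, 0 < m b) (eig : β → ℂ) :
    spectrum ℂ (jordanMatrix m eig) = Set.range eig := by
  ext z
  have h0 : z ∈ spectrum ℂ (jordanMatrix m eig) ↔ ∃ w ≠ 0, (jordanMatrix m eig - scalar _ z) *ᵥ w = 0 := by
    rw [exists_mulVec_eq_zero_iff, spectrum.mem_iff, ← IsUnit.neg_iff, neg_sub,
      isUnit_iff_isUnit_det, isUnit_iff_ne_zero, not_not]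
    rfl
  rw [h0]
  have h1 := fun w => jordanMatrix_sub_pow_mulVec_eq_zero_iff m eig z 1 w
  simp only [pow_one] at h1
  simp only [h1]
  constructor
  · rintro ⟨w, hw, h⟩
    obtain ⟨x, hx⟩ := Function.ne_iff.1 hw
    by_contra hz
    exact hx (h x fun h' => hz ⟨x.1, h'.1⟩)
  · rintro ⟨b, rfl⟩
    refine ⟨Pi.single ⟨b, 0, hm b⟩ 1, ?_, fun x hx => ?_⟩
    · simp
    · refine Pi.single_eq_of_ne ?_ _
      rintro rfl
      exact hx ⟨rfl, by simp⟩

/-- A nonsingular Jordan matrix with `s` distinct eigenvalues has `p ^ s` primary `p`-th roots, one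
for each choice of a branch for each eigenvalue. -/
lemma ncard_primary {p : ℕ} (hp : p ≠ 0) {m : β → ℕ} (hm : ∀ b, 0 < m b)
    {eig : β → ℂ} (he : ∀ b, eig b ≠ 0) :
    {X : Matrix (Σ b, Fin (m b)) (Σ b, Fin (m b)) ℂ | X ^ p = jordanMatrix m eig ∧
      ∃ q : Polynomial ℂ, X = Polynomial.aeval (jordanMatrix m eig) q}.ncard =
      p ^ (Set.range eig).ncard := by
  -- the consistent choices of branches are the functions of the eigenvalue
  let F : (Set.range eig → Fin p) → Matrix (Σ b, Fin (m b)) (Σ b, Fin (m b)) ℂ :=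
    fun c => branchJordan m eig fun b => c ⟨eig b, b, rfl⟩
  have hF : Function.Injective F := by
    intro c c' h
    have := branchJordan_injective hp hm he h
    funext ⟨z, b, hb⟩
    subst hb
    exact congrFun this b
  have hr : {X : Matrix (Σ b, Fin (m b)) (Σ b, Fin (m b)) ℂ | X ^ p = jordanMatrix m eig ∧
      ∃ q : Polynomial ℂ, X = Polynomial.aeval (jordanMatrix m eig) q} = Set.range F := by
    ext X
    constructor
    · rintro ⟨h1, q, rfl⟩
      obtain ⟨j, hj⟩ := exists_branchJordan_of_aeval hp hm he h1
      have hc := consistent_of_branchJordan_eq_aeval hp hm he hj.symm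
      refine ⟨fun z => j z.2.choose, ?_⟩
      rw [hj]
      change branchJordan m eig _ = _
      congr 1
      funext b
      exact hc _ _ (Set.mem_range_self (f := eig) b).choose_spec
    · rintro ⟨c, rfl⟩
      refine ⟨branchJordan_pow hp m he _, exists_aeval_eq_branchJordan m eig ?_⟩
      intro b b' h
      simp only [h]
  rw [hr, ← Nat.card_coe_set_eq, ← Nat.card_congr (Equiv.ofInjective F hF), Nat.card_fun,
    Nat.card_fin, Nat.card_coe_set_eq]

end

end MatrixRoots

/-! ### The complex Jordan form of a real Jordan matrix -/

namespace MatrixRoots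

open Matrix

lemma toComplex_mul {l m n : Type*} [Fintype m] (M : Matrix l m ℝ) (N : Matrix m n ℝ) :
    toComplex (M * N) = toComplex M * toComplex N :=
  Matrix.map_mul (f := Complex.ofRealHom)

lemma toComplex_one {n : Type*} [DecidableEq n] : toComplex (1 : Matrix n n ℝ) = 1 :=
  Matrix.map_one _ Complex.ofReal_zero Complex.ofReal_one

/-- Conjugation by `P_m` interleaves the rows of two blocks. -/
lemma permP_mul_mul_transpose {m : ℕ} (M : Fin 2 → Matrix (Fin m) (Fin m) ℂ) :
    permP m * fromBlocks (M 0) 0 0 (M 1) * (permP m)ᵀ = blockDiagonal M := by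
  ext ⟨a, u⟩ ⟨b, v⟩
  fin_cases u <;> fin_cases v <;>
    simp [Matrix.mul_apply, permP, blockDiagonal_apply, Fintype.sum_sum_type]

lemma isUnit_diagS (m : ℕ) : IsUnit (diagS m) := by
  rw [isUnit_iff_isUnit_det, diagS, det_kronecker, det_one, one_pow, one_mul]
  refine IsUnit.pow _ (isUnit_iff_ne_zero.2 ?_)
  simp [det_fin_two]

/-- The columns `(-i, 1)` and `(-i, -1)` of `S` are eigenvectors of the block `C (z)` with the
eigenvalues `z` and `z̄`, so that conjugation by `S ⊕ ⋯ ⊕ S` splits `C_m (z)` into `J_m (z)` and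
`J_m (z̄)`. -/
lemma toComplex_realJordanBlock (m : ℕ) (z : ℂ) :
    toComplex (realJordanBlock m z) =
      diagS m * blockDiagonal (fun u : Fin 2 => jordan m (if u = 0 then z else conj z)) *
        (diagS m)⁻¹ := by
  set S : Matrix (Fin 2) (Fin 2) ℂ := !![-Complex.I, -Complex.I; 1, -1] with hS
  have h1 : toComplex (realJordanBlock m z) =
      (1 : Matrix (Fin m) (Fin m) ℂ) ⊗ₖ toComplex (rotBlock z) + shift ℂ m ⊗ₖ 1 := by
    ext ⟨a, u⟩ ⟨b, v⟩
    simp only [toComplex, realJordanBlock, map_apply, Matrix.add_apply, kroneckerMap_apply, one_apply,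
      shift, of_apply]
    push_cast
    split_ifs <;> simp
  have h2 : blockDiagonal (fun u : Fin 2 => jordan m (if u = 0 then z else conj z)) =
      (1 : Matrix (Fin m) (Fin m) ℂ) ⊗ₖ diagonal ![z, conj z] + shift ℂ m ⊗ₖ 1 := by
    ext ⟨a, u⟩ ⟨b, v⟩
    simp only [jordan_eq, blockDiagonal_apply, Matrix.add_apply, scalar_apply, diagonal_apply,
      kroneckerMap_apply, one_apply, shift, of_apply]
    fin_cases u <;> fin_cases v <;> simp
  have h3 : toComplex (rotBlock z) * S = S * diagonal ![z, conj z] := by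
    have hz := Complex.re_add_im z
    have hz' : conj z = z.re - z.im * Complex.I := by
      apply Complex.ext <;> simp
    ext u v
    fin_cases u <;> fin_cases v <;>
      simp [toComplex, rotBlock, hS, Matrix.mul_apply, Fin.sum_univ_two, hz'] <;>
      (try conv_rhs => rw [← hz]) <;> ring_nf <;> simp <;> ring
  have h4 : toComplex (realJordanBlock m z) * diagS m =
      diagS m * blockDiagonal (fun u : Fin 2 => jordan m (if u = 0 then z else conj z)) := by
    rw [h1, h2, diagS, add_mul, mul_add, ← mul_kronecker_mul, ← mul_kronecker_mul,
      ← mul_kronecker_mul, ← mul_kronecker_mul, ← hS, h3]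
    simp
  rw [← h4, mul_nonsing_inv_cancel_right _ _ ((isUnit_iff_isUnit_det _).1 (isUnit_diagS m))]

lemma branchRealBlock_eq (p m : ℕ) (j : Fin 2 → ℕ) (z : ℂ) :
    branchRealBlock p (j 0) (j 1) m z =
      diagS m * blockDiagonal (fun u : Fin 2 => toeplitz m
        (branchSeries p (j u) (if u = 0 then z else conj z))) * (diagS m)⁻¹ := by
  rw [branchRealBlock, ← permP_mul_mul_transpose, branchBlock_eq, branchBlock_eq]
  simp only [Matrix.mul_assoc]
  rfl

namespace RealJordanData

variable (D : RealJordanData)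

/-- The size of a complex Jordan block. -/
def size : D.Block → ℕ := Sum.elim D.realSize fun x => D.cplxSize x.1

lemma size_pos (b : D.Block) : 0 < D.size b := by
  rcases b with k | x
  · exact D.realSize_pos k
  · exact D.cplxSize_pos x.1

/-- The rearrangement of the rows of `J_ℝ` that collects those of each complex Jordan block. -/
def idxEquiv : D.Idx ≃ Σ b : D.Block, Fin (D.size b) where
  toFun
    | Sum.inl ⟨k, i⟩ => ⟨Sum.inl k, i⟩
    | Sum.inr ⟨k, i, u⟩ => ⟨Sum.inr (k, u), i⟩
  invFun
    | ⟨Sum.inl k, i⟩ => Sum.inl ⟨k, i⟩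
    | ⟨Sum.inr (k, u), i⟩ => Sum.inr ⟨k, i, u⟩
  left_inv := by rintro (⟨k, i⟩ | ⟨k, i, u⟩) <;> rfl
  right_inv := by rintro ⟨k | ⟨k, u⟩, i⟩ <;> rfl

lemma blockDiagonal'_submatrix_idxEquiv
    (M : ∀ b : D.Block, Matrix (Fin (D.size b)) (Fin (D.size b)) ℂ)
    (M₁ : ∀ k : Fin D.r, Matrix (Fin (D.realSize k)) (Fin (D.realSize k)) ℂ)
    (M₂ : ∀ k : Fin D.c, Fin 2 → Matrix (Fin (D.cplxSize k)) (Fin (D.cplxSize k)) ℂ)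
    (h₁ : ∀ k, M (Sum.inl k) = M₁ k) (h₂ : ∀ k u, M (Sum.inr (k, u)) = M₂ k u) :
    (blockDiagonal' M).submatrix D.idxEquiv D.idxEquiv =
      fromBlocks (blockDiagonal' M₁) 0 0 (blockDiagonal' fun k => blockDiagonal (M₂ k)) := by
  ext (⟨k, i⟩ | ⟨k, i, u⟩) (⟨k', i'⟩ | ⟨k', i', u'⟩)
  · rw [fromBlocks_apply₁₁]
    by_cases h : k = k'
    · subst h
      rw [blockDiagonal'_apply_eq, ← h₁]
      exact blockDiagonal'_apply_eq M (Sum.inl k) i i'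
    · rw [blockDiagonal'_apply_ne _ _ _ h]
      exact blockDiagonal'_apply_ne M (k := Sum.inl k) (k' := Sum.inl k') i i' (by simpa using h)
  · exact blockDiagonal'_apply_ne M (k := Sum.inl k) (k' := Sum.inr (k', u')) i i' (by simp)
  · exact blockDiagonal'_apply_ne M (k := Sum.inr (k, u)) (k' := Sum.inl k') i i' (by simp)
  · rw [fromBlocks_apply₂₂]
    by_cases h : k = k'
    · subst h
      rw [blockDiagonal'_apply_eq, blockDiagonal_apply]
      split_ifs with hu
      · simp only at hu
        subst hu
        rw [← h₂]
        exact blockDiagonal'_apply_eq M (Sum.inr (k, u)) i i'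
      · exact blockDiagonal'_apply_ne M (k := Sum.inr (k, u)) (k' := Sum.inr (k, u')) i i'
          (by simpa using hu)
    · rw [blockDiagonal'_apply_ne _ _ _ h]
      exact blockDiagonal'_apply_ne M (k := Sum.inr (k, u)) (k' := Sum.inr (k', u')) i i'
        (by simpa using fun h' => absurd h' h)

/-- One complex change of basis `Q` turns the real Jordan form into the complex one, and the
matrices `branchMatrix` into the corresponding roots of the complex Jordan form. -/
lemma exists_complex_form :
    ∃ (Q : Matrix D.Idx (Σ b, Fin (D.size b)) ℂ) (Q' : Matrix (Σ b, Fin (D.size b)) D.Idx ℂ),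
      Q * Q' = 1 ∧ Q' * Q = 1 ∧
      toComplex D.matrix = Q * jordanMatrix D.size D.eig * Q' ∧
      ∀ (p : ℕ) (j : D.Block → Fin p),
        D.branchMatrix j = Q * branchJordan D.size D.eig j * Q' := by
  obtain ⟨P, P', hP, hP', hPM⟩ := exists_submatrix_eq_conj D.idxEquiv
  let S : ∀ k : Fin D.c, Matrix (Fin (D.cplxSize k) × Fin 2) (Fin (D.cplxSize k) × Fin 2) ℂ :=
    fun k => diagS (D.cplxSize k)
  let G : Matrix D.Idx D.Idx ℂ := fromBlocks 1 0 0 (blockDiagonal' S)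
  let G' : Matrix D.Idx D.Idx ℂ := fromBlocks 1 0 0 (blockDiagonal' fun k => (S k)⁻¹)
  have hS : ∀ k, IsUnit (S k).det := fun k => (isUnit_iff_isUnit_det _).1 (isUnit_diagS _)
  have hG : G * G' = 1 := by
    simp only [G, G', fromBlocks_multiply, ← blockDiagonal'_mul, mul_nonsing_inv _ (hS _)]
    simp only [Matrix.mul_one, Matrix.mul_zero, Matrix.zero_mul, add_zero, zero_add]
    rw [← fromBlocks_one]
    congr 1
    exact blockDiagonal'_one
  have hG' : G' * G = 1 := mul_eq_one_comm.1 hG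
  have key : ∀ (M : ∀ b : D.Block, Matrix (Fin (D.size b)) (Fin (D.size b)) ℂ)
      (M₁ : ∀ k : Fin D.r, Matrix (Fin (D.realSize k)) (Fin (D.realSize k)) ℂ)
      (M₂ : ∀ k : Fin D.c, Fin 2 → Matrix (Fin (D.cplxSize k)) (Fin (D.cplxSize k)) ℂ)
      (_ : ∀ k, M (Sum.inl k) = M₁ k) (_ : ∀ k u, M (Sum.inr (k, u)) = M₂ k u),
      G * P * blockDiagonal' M * (P' * G') =
        fromBlocks (blockDiagonal' M₁) 0 0 (blockDiagonal' fun k =>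
          diagS (D.cplxSize k) * blockDiagonal (M₂ k) * (diagS (D.cplxSize k))⁻¹) := by
    intro M M₁ M₂ h₁ h₂
    have : G * P * blockDiagonal' M * (P' * G') = G * (P * blockDiagonal' M * P') * G' := by
      simp only [Matrix.mul_assoc]
    rw [this, ← hPM, D.blockDiagonal'_submatrix_idxEquiv M M₁ M₂ h₁ h₂]
    simp only [G, G', fromBlocks_multiply, Matrix.mul_one, Matrix.one_mul, Matrix.mul_zero,
      Matrix.zero_mul, add_zero, zero_add, S]
    congr 1
    rw [blockDiagonal'_mul, blockDiagonal'_mul]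
  refine ⟨G * P, P' * G', ?_, ?_, ?_, fun p j => ?_⟩
  · rw [Matrix.mul_assoc, ← Matrix.mul_assoc P, hP, Matrix.one_mul, hG]
  · rw [Matrix.mul_assoc, ← Matrix.mul_assoc G', hG', Matrix.one_mul, hP']
  · rw [jordanMatrix, key _ (fun k => jordan (D.realSize k) (D.realEig k))
      (fun k u => jordan (D.cplxSize k) (if u = 0 then D.cplxEig k else conj (D.cplxEig k)))
      (fun _ => rfl) (fun _ _ => rfl), RealJordanData.matrix, toComplex, fromBlocks_map,
      blockDiagonal'_map _ _ Complex.ofReal_zero, blockDiagonal'_map _ _ Complex.ofReal_zero,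
      Matrix.map_zero _ Complex.ofReal_zero, Matrix.map_zero _ Complex.ofReal_zero]
    congr 2
    · funext k
      rw [jordan_eq]
      ext a b
      simp only [jordanBlock, map_apply, Matrix.add_apply, scalar_apply, diagonal_apply, shift,
        of_apply]
      push_cast
      split_ifs <;> simp
    · funext k
      exact toComplex_realJordanBlock _ _
  · rw [branchJordan, toeplitzMatrix_apply,
      key _ (fun k => toeplitz (D.realSize k) (branchSeries p (j (Sum.inl k)) (D.realEig k)))
      (fun k u => toeplitz (D.cplxSize k) (branchSeries p (j (Sum.inr (k, u)))
        (if u = 0 then D.cplxEig k else conj (D.cplxEig k))))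
      (fun _ => rfl) (fun _ _ => rfl), branchMatrix]
    congr 2
    · funext k
      exact branchBlock_eq _ _ _ _
    · funext k
      exact branchRealBlock_eq p (D.cplxSize k) (fun u => j (Sum.inr (k, u))) _

end RealJordanData

end MatrixRoots

/-! ### Existence of the real Jordan form -/

namespace MatrixRoots

open Matrix

/-- Real matrices that are similar over `ℂ` are similar over `ℝ`: if `P + i Q` is a complex
similarity, then so is `P + t Q` for all but finitely many real `t`. -/
lemma exists_real_similarity {n κ : Type*} [Fintype n] [DecidableEq n] [Fintype κ] [DecidableEq κ]
    {A : Matrix n n ℝ} {B : Matrix κ κ ℝ} {V : Matrix n κ ℂ} {V' : Matrix κ n ℂ}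
    (h : V * V' = 1) (h' : V' * V = 1) (hA : toComplex A = V * toComplex B * V') :
    ∃ (R : Matrix n κ ℝ) (R' : Matrix κ n ℝ), R * R' = 1 ∧ R' * R = 1 ∧ R' * A * R = B := by
  let ε : n ≃ κ := Fintype.equivOfCardEq (card_eq_of_mul_eq_one h h')
  have hAV : toComplex A * V = V * toComplex B := by
    rw [hA, Matrix.mul_assoc, h', Matrix.mul_one]
  let P : Matrix n κ ℝ := V.map Complex.re
  let Q : Matrix n κ ℝ := V.map Complex.im
  have hP : A * P = P * B := by
    ext i k
    have := congrArg Complex.re (congrFun (congrFun hAV i) k)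
    simpa [Matrix.mul_apply, toComplex, P] using this
  have hQ : A * Q = Q * B := by
    ext i k
    have := congrArg Complex.im (congrFun (congrFun hAV i) k)
    simpa [Matrix.mul_apply, toComplex, Q] using this
  let F : Matrix n n (Polynomial ℝ) := Matrix.of fun i k =>
    Polynomial.C (P i (ε k)) + Polynomial.X * Polynomial.C (Q i (ε k))
  have hFV : (Polynomial.aeval Complex.I).toRingHom.mapMatrix F = V.submatrix id ε := by
    ext i k
    simp only [F, P, Q, RingHom.mapMatrix_apply, map_apply, of_apply, submatrix_apply, id,
      AlgHom.toRingHom_eq_coe, RingHom.coe_coe, map_add, map_mul, Polynomial.aeval_C,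
      Polynomial.aeval_X]
    rw [mul_comm]
    exact Complex.re_add_im _
  -- at `i`, the polynomial `det (P + X Q)` takes the value `det V`
  have hF0 : F.det ≠ 0 := by
    intro h0
    have h1 : (V.submatrix id ε).det = 0 := by
      rw [← hFV, ← RingHom.map_det, h0, map_zero]
    have h2 : V.submatrix id ε * V'.submatrix ε id = 1 := by
      rw [← submatrix_mul _ _ _ _ _ ε.bijective, h, submatrix_id_id]
    have h3 := congrArg det h2
    rw [det_mul, h1, zero_mul, det_one] at h3
    exact zero_ne_one h3
  obtain ⟨t, ht⟩ : ∃ t : ℝ, F.det.eval t ≠ 0 := by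
    by_contra hc
    push Not at hc
    exact hF0 (Polynomial.funext fun t => by rw [hc, Polynomial.eval_zero])
  let R : Matrix n κ ℝ := P + t • Q
  have hFR : (Polynomial.evalRingHom t).mapMatrix F = R.submatrix id ε := by
    ext i k
    simp only [F, R, RingHom.mapMatrix_apply, map_apply, of_apply, submatrix_apply, id,
      Polynomial.eval_add, Polynomial.eval_mul, Polynomial.coe_evalRingHom, Polynomial.eval_C, Polynomial.eval_X,
      Matrix.add_apply, Matrix.smul_apply, smul_eq_mul]
  have hdet : IsUnit (R.submatrix id ε).det := by
    rw [← hFR, ← RingHom.map_det]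
    exact isUnit_iff_ne_zero.2 ht
  let R' : Matrix κ n ℝ := (R.submatrix id ε)⁻¹.submatrix ε.symm id
  have hR : R = (R.submatrix id ε).submatrix id ε.symm := by
    ext i k
    simp
  have hRR' : R * R' = 1 := by
    have := submatrix_mul (R.submatrix id ε) (R.submatrix id ε)⁻¹ id ε.symm id ε.symm.bijective
    rwa [mul_nonsing_inv _ hdet, ← hR, submatrix_id_id, eq_comm] at this
  have hR'R : R' * R = 1 := by
    have := submatrix_mul (R.submatrix id ε)⁻¹ (R.submatrix id ε) ε.symm id ε.symm
      Function.bijective_id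
    rwa [nonsing_inv_mul _ hdet, ← hR, submatrix_one_equiv, eq_comm] at this
  refine ⟨R, R', hRR', hR'R, ?_⟩
  have hAR : A * R = R * B := by
    simp only [R]
    rw [Matrix.mul_add, Matrix.add_mul, hP, Matrix.mul_smul, Matrix.smul_mul, hQ]
  rw [Matrix.mul_assoc, hAR, ← Matrix.mul_assoc, hR'R, Matrix.one_mul]

lemma jordan_map_conj (m : ℕ) (z : ℂ) :
    (jordan m z).map conj = jordan m (conj z) := by
  ext a b
  simp only [jordan_eq, map_apply, Matrix.add_apply, scalar_apply, diagonal_apply, shift, of_apply,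
    map_add]
  split_ifs <;> simp

/-- The blocks of the complex Jordan form of a real matrix come in conjugate pairs, by uniqueness
of the Jordan form, because complex conjugation fixes the matrix. -/
lemma exists_conj_equiv {n : Type*} [Fintype n] [DecidableEq n] {A : Matrix n n ℝ}
    {β : Type*} [Fintype β] [DecidableEq β] {m : β → ℕ} {eig : β → ℂ} (hm : ∀ b, 0 < m b)
    {W : Matrix n (Σ b, Fin (m b)) ℂ} {W' : Matrix (Σ b, Fin (m b)) n ℂ}
    (h : W * W' = 1) (h' : W' * W = 1) (hA : toComplex A = W * jordanMatrix m eig * W') :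
    ∃ σ : β ≃ β, (∀ b, m (σ b) = m b) ∧ ∀ b, eig (σ b) = conj (eig b) := by
  have hJ : (jordanMatrix m eig).map conj = jordanMatrix m fun b => conj (eig b) := by
    rw [jordanMatrix, blockDiagonal'_map _ _ (map_zero _), jordanMatrix]
    congr 1
    funext b
    exact jordan_map_conj _ _
  have h1 : W.map conj * W'.map conj = 1 := by
    rw [← Matrix.map_mul, h]
    exact Matrix.map_one _ (map_zero _) (map_one _)
  have h1' : W'.map conj * W.map conj = 1 := by
    rw [← Matrix.map_mul, h']
    exact Matrix.map_one _ (map_zero _) (map_one _)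
  have h2 : toComplex A = W.map conj * (jordanMatrix m fun b => conj (eig b)) * W'.map conj := by
    rw [← hJ, ← Matrix.map_mul, ← Matrix.map_mul, ← hA]
    ext i k
    simp [toComplex]
  have h3 : W' * toComplex A * W = jordanMatrix m eig := by
    rw [hA]
    simp only [← Matrix.mul_assoc, h', Matrix.one_mul]
    rw [Matrix.mul_assoc, h', Matrix.mul_one]
  obtain ⟨σ, hσm, hσe⟩ := exists_equiv_of_jordanMatrix_similar (eig := eig)
    (eig' := fun b => conj (eig b)) hm hm (W' * W.map conj)
    (W'.map conj * W)
    (by rw [Matrix.mul_assoc, ← Matrix.mul_assoc (W.map _), h1, Matrix.one_mul, h'])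
    (by rw [Matrix.mul_assoc, ← Matrix.mul_assoc W, h, Matrix.one_mul, h1'])
    (by rw [← h3, h2]; simp only [Matrix.mul_assoc])
  refine ⟨σ, hσm, fun b => ?_⟩
  rw [← hσe b, Complex.conj_conj]

/-- Existence of the real Jordan form. -/
lemma nonempty_realJordanForm {n : ℕ} (A : Matrix (Fin n) (Fin n) ℝ) :
    Nonempty (RealJordanForm A) := by
  obtain ⟨β, _, _, m, eig, Y, W, W', h, h', hW, hm, hY⟩ :=
    exists_blockDiagonal (toComplex A) Polynomial.X (by simp)
  simp only [Polynomial.aeval_X] at hY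
  have hA : toComplex A = W * jordanMatrix m eig * W' := by
    rw [hW, jordanMatrix]
    congr 3
    exact funext hY
  obtain ⟨σ, hσm, hσe⟩ := exists_conj_equiv hm h h' hA
  let er := (Fintype.equivFin {b // (eig b).im = 0}).symm
  let ec := (Fintype.equivFin {b // 0 < (eig b).im}).symm
  let D : RealJordanData :=
    { r := Fintype.card {b // (eig b).im = 0}
      c := Fintype.card {b // 0 < (eig b).im}
      realSize := fun k => m (er k)
      realSize_pos := fun k => hm _
      realEig := fun k => (eig (er k)).re
      cplxSize := fun k => m (ec k)
      cplxSize_pos := fun k => hm _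
      cplxEig := fun k => eig (ec k)
      cplxEig_im := fun k => (ec k).2.ne' }
  -- the block `J_m (z̄)` of a pair is the partner under `σ` of the block `J_m (z)`, `Im z > 0`
  let τ : D.Block → β := fun b => match b with
    | Sum.inl k => er k
    | Sum.inr (k, u) => if u = 0 then ec k else σ (ec k)
  have hτm : ∀ b, m (τ b) = D.size b := by
    rintro (k | ⟨k, u⟩)
    · rfl
    · change m (if u = 0 then _ else _) = m (ec k)
      split_ifs
      · rfl
      · exact hσm _
  have hτe : ∀ b, eig (τ b) = D.eig b := by
    rintro (k | ⟨k, u⟩)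
    · change eig (er k) = ((eig (er k)).re : ℂ)
      apply Complex.ext
      · simp
      · simpa using (er k).2
    · change eig (if u = 0 then _ else _) = if u = 0 then eig (ec k) else conj (eig (ec k))
      split_ifs
      · rfl
      · exact hσe _
  have hτ : Function.Bijective τ := by
    have him : ∀ b, (eig (σ b)).im = -(eig b).im := by
      intro b
      rw [hσe, Complex.conj_im]
    constructor
    · have hr : ∀ k, (eig (er k)).im = 0 := fun k => (er k).2
      have hc : ∀ k, 0 < (eig (ec k)).im := fun k => (ec k).2
      rintro (k | ⟨k, u⟩) (k' | ⟨k', u'⟩) hk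
      · exact congrArg _ (er.injective (Subtype.ext hk))
      · exfalso
        have := congrArg (fun b => (eig b).im) hk
        simp only [τ] at this
        have h1 := hr k
        have h2 := hc k'
        split_ifs at this
        · linarith
        · rw [him] at this
          linarith
      · exfalso
        have := congrArg (fun b => (eig b).im) hk
        simp only [τ] at this
        have h1 := hr k'
        have h2 := hc k
        split_ifs at this
        · linarith
        · rw [him] at this
          linarith
      · have h1 := hc k
        have h2 := hc k'
        have := congrArg (fun b => (eig b).im) hk
        simp only [τ] at this hk
        fin_cases u <;> fin_cases u' <;> simp [him] at this hk ⊢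
        · exact ec.injective (Subtype.ext hk)
        · linarith
        · linarith
        · exact ec.injective (Subtype.ext hk)
    · intro b
      rcases lt_trichotomy (eig b).im 0 with hb | hb | hb
      · have hb' : 0 < (eig (σ.symm b)).im := by
          have := him (σ.symm b)
          rw [σ.apply_symm_apply] at this
          linarith
        refine ⟨Sum.inr (ec.symm ⟨σ.symm b, hb'⟩, 1), ?_⟩
        simp [τ]
      · exact ⟨Sum.inl (er.symm ⟨b, hb⟩), by simp [τ]⟩
      · exact ⟨Sum.inr (ec.symm ⟨b, hb⟩, 0), by simp [τ]⟩
  obtain ⟨P, P', hP, hP', hPt⟩ := exists_perm_toeplitzMatrix (Equiv.ofBijective τ hτ) hτm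
  obtain ⟨Q, Q', hQ, hQ', hQD, -⟩ := D.exists_complex_form
  have hPJ : jordanMatrix D.size D.eig = P * jordanMatrix m eig * P' := by
    rw [jordanMatrix_eq, jordanMatrix_eq, ← hPt]
    simp only [Equiv.ofBijective_apply, hτe]
  -- `A = V J_ℝ V⁻¹` with `V = W P⁻¹ Q⁻¹`
  obtain ⟨R, R', hR, hR', hRA⟩ := exists_real_similarity (A := A) (B := D.matrix)
    (V := W * P' * Q') (V' := Q * P * W')
    (by
      have e1 : Q' * (Q * (P * W')) = P * W' := by rw [← Matrix.mul_assoc, hQ', Matrix.one_mul]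
      have e2 : P' * (P * W') = W' := by rw [← Matrix.mul_assoc, hP', Matrix.one_mul]
      simp only [Matrix.mul_assoc, e1, e2, h])
    (by
      have e1 : W' * (W * (P' * Q')) = P' * Q' := by rw [← Matrix.mul_assoc, h', Matrix.one_mul]
      have e2 : P * (P' * Q') = Q' := by rw [← Matrix.mul_assoc, hP, Matrix.one_mul]
      simp only [Matrix.mul_assoc, e1, e2, hQ])
    (by
      rw [hQD, hPJ, hA]
      have e3 : ∀ N : Matrix (Σ b, Fin (D.size b)) (Fin n) ℂ, Q' * (Q * N) = N := by
        intro N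
        rw [← Matrix.mul_assoc, hQ', Matrix.one_mul]
      have e4 : ∀ N : Matrix (Σ b, Fin (m b)) (Fin n) ℂ, P' * (P * N) = N := by
        intro N
        rw [← Matrix.mul_assoc, hP', Matrix.one_mul]
      simp only [Matrix.mul_assoc, e3, e4])
  exact ⟨{ D with
    R := R
    Rinv := R'
    mul_Rinv := hR
    Rinv_mul := hR'
    Rinv_mul_mul := hRA }⟩

end MatrixRoots

/-! ### Roots of a real matrix -/

namespace MatrixRoots

open Matrix

lemma isUnit_toComplex {n : ℕ} {A : Matrix (Fin n) (Fin n) ℝ} (hA : A.det ≠ 0) :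
    IsUnit (toComplex A) := by
  have : IsUnit A := (isUnit_iff_isUnit_det A).2 (isUnit_iff_ne_zero.2 hA)
  exact this.map (Complex.ofRealHom.mapMatrix (m := Fin n))

namespace RealJordanData

variable (D : RealJordanData)

lemma branchMatrix_pow {p : ℕ} (hp : p ≠ 0) (he : ∀ b, D.eig b ≠ 0) (j : D.Block → Fin p) :
    D.branchMatrix j ^ p = toComplex D.matrix := by
  obtain ⟨Q, Q', hQ, hQ', hD, hB⟩ := D.exists_complex_form
  rw [hD, hB, ← conjAlgEquiv_apply Q Q' hQ hQ', ← conjAlgEquiv_apply Q Q' hQ hQ', ← map_pow,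
    branchJordan_pow hp _ he]

/-- A matrix `branchMatrix` is a polynomial in `J_ℝ` precisely if its branches agree on the blocks
with the same eigenvalue. -/
lemma branchMatrix_eq_aeval_iff {p : ℕ} (hp : p ≠ 0) (he : ∀ b, D.eig b ≠ 0)
    (j : D.Block → Fin p) :
    (∃ q : Polynomial ℂ, D.branchMatrix j = Polynomial.aeval (toComplex D.matrix) q) ↔
      D.Consistent j := by
  obtain ⟨Q, Q', hQ, hQ', hD, hB⟩ := D.exists_complex_form
  rw [hD, hB]
  simp only [← conjAlgEquiv_apply Q Q' hQ hQ', Polynomial.aeval_algHom_apply,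
    (conjAlgEquiv Q Q' hQ hQ').injective.eq_iff]
  constructor
  · rintro ⟨q, hq⟩ b b' hb
    exact consistent_of_branchJordan_eq_aeval hp D.size_pos he hq b b' hb
  · exact exists_aeval_eq_branchJordan _ _

lemma exists_branchMatrix_of_aeval {p : ℕ} (hp : p ≠ 0) (he : ∀ b, D.eig b ≠ 0)
    {q : Polynomial ℂ}
    (h : Polynomial.aeval (toComplex D.matrix) q ^ p = toComplex D.matrix) :
    ∃ j : D.Block → Fin p, Polynomial.aeval (toComplex D.matrix) q = D.branchMatrix j := by
  obtain ⟨Q, Q', hQ, hQ', hD, hB⟩ := D.exists_complex_form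
  simp only [hB]
  rw [hD] at h ⊢
  simp only [← conjAlgEquiv_apply Q Q' hQ hQ', Polynomial.aeval_algHom_apply,
    (conjAlgEquiv Q Q' hQ hQ').injective.eq_iff, ← map_pow] at h ⊢
  exact exists_branchJordan_of_aeval hp D.size_pos he (by rwa [map_pow] at h)

/-- Every `p`-th root of `J_ℝ` is conjugate to some `branchMatrix` by a matrix that commutes with
`J_ℝ`. -/
lemma exists_conj_branchMatrix {p : ℕ} (hp : p ≠ 0) (he : ∀ b, D.eig b ≠ 0)
    {Y : Matrix D.Idx D.Idx ℂ} (hY : Y ^ p = toComplex D.matrix) :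
    ∃ (j : D.Block → Fin p) (U : Matrix D.Idx D.Idx ℂ), IsUnit U ∧
      U * toComplex D.matrix = toComplex D.matrix * U ∧ Y = U * D.branchMatrix j * U⁻¹ := by
  obtain ⟨Q, Q', hQ, hQ', hD, hB⟩ := D.exists_complex_form
  obtain ⟨Y, rfl⟩ := (conjAlgEquiv Q Q' hQ hQ').surjective Y
  have hY' : Y ^ p = jordanMatrix D.size D.eig := by
    rw [hD, ← conjAlgEquiv_apply Q Q' hQ hQ', ← map_pow] at hY
    exact (conjAlgEquiv Q Q' hQ hQ').injective hY
  obtain ⟨j, U, U', hU, hU', hYU⟩ := exists_conj_branchJordan hp D.size_pos he hY'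
  have hV : conjAlgEquiv Q Q' hQ hQ' U * conjAlgEquiv Q Q' hQ hQ' U' = 1 := by
    rw [← map_mul, hU, map_one]
  have hV' : conjAlgEquiv Q Q' hQ hQ' U' * conjAlgEquiv Q Q' hQ hQ' U = 1 := by
    rw [← map_mul, hU', map_one]
  have hYV : conjAlgEquiv Q Q' hQ hQ' Y =
      conjAlgEquiv Q Q' hQ hQ' U * D.branchMatrix j * (conjAlgEquiv Q Q' hQ hQ' U)⁻¹ := by
    rw [inv_eq_right_inv hV, hB, ← conjAlgEquiv_apply Q Q' hQ hQ', ← map_mul, ← map_mul, ← hYU]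
  refine ⟨j, conjAlgEquiv Q Q' hQ hQ' U, IsUnit.of_mul_eq_one _ hV, ?_, hYV⟩
  rw [hD, ← conjAlgEquiv_apply Q Q' hQ hQ', ← map_mul, ← map_mul]
  congr 1
  -- `J = X ^ p = U J U⁻¹`, since `X = U F U⁻¹` with `F ^ p = J`
  have h1 : jordanMatrix D.size D.eig = U * jordanMatrix D.size D.eig * U' := by
    rw [← conjAlgEquiv_apply U U' hU hU', ← branchJordan_pow hp D.size he j, map_pow,
      conjAlgEquiv_apply, ← hYU, hY', branchJordan_pow hp D.size he j]
  conv_rhs => rw [h1]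
  rw [Matrix.mul_assoc _ U', hU', Matrix.mul_one]

end RealJordanData

namespace RealJordanForm

variable {n : ℕ} {A : Matrix (Fin n) (Fin n) ℝ} (D : RealJordanForm A)

/-- Conjugation by the matrix `R` of a real Jordan form. -/
noncomputable def conjR : Matrix D.Idx D.Idx ℂ ≃ₐ[ℂ] Matrix (Fin n) (Fin n) ℂ :=
  conjAlgEquiv (toComplex D.R) (toComplex D.Rinv)
    (by rw [← toComplex_mul, D.mul_Rinv, toComplex_one])
    (by rw [← toComplex_mul, D.Rinv_mul, toComplex_one])

lemma conjR_apply (M : Matrix D.Idx D.Idx ℂ) :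
    D.conjR M = toComplex D.R * M * toComplex D.Rinv := rfl

lemma conjR_matrix : D.conjR (toComplex D.matrix) = toComplex A := by
  rw [conjR_apply, ← D.Rinv_mul_mul, ← toComplex_mul, ← toComplex_mul]
  congr 1
  have h := D.mul_Rinv
  simp only [← Matrix.mul_assoc, h, Matrix.one_mul]
  rw [Matrix.mul_assoc, h, Matrix.mul_one]

lemma conjR_branchMatrix {p : ℕ} (j : D.Block → Fin p) :
    D.conjR (D.branchMatrix j) = D.root j := rfl

lemma conjR_conj_branchMatrix {p : ℕ} (j : D.Block → Fin p) (U : Matrix D.Idx D.Idx ℂ) :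
    D.conjR (U * D.branchMatrix j * U⁻¹) = D.rootConj j U := by
  rw [conjR_apply, rootConj]
  simp only [Matrix.mul_assoc]

lemma isRoot_conjR_iff {p : ℕ} (Y : Matrix D.Idx D.Idx ℂ) :
    IsRoot p A (D.conjR Y) ↔ Y ^ p = toComplex D.matrix := by
  rw [IsRoot, ← conjR_matrix D, ← map_pow, D.conjR.injective.eq_iff]

lemma conjR_eq_aeval_iff (Y : Matrix D.Idx D.Idx ℂ) (q : Polynomial ℂ) :
    D.conjR Y = Polynomial.aeval (toComplex A) q ↔
      Y = Polynomial.aeval (toComplex D.matrix) q := by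
  rw [← conjR_matrix D, Polynomial.aeval_algHom_apply, D.conjR.injective.eq_iff]

lemma spectrum_eq : spectrum ℂ (toComplex A) = Set.range D.eig := by
  obtain ⟨Q, Q', hQ, hQ', hD, -⟩ := D.exists_complex_form
  rw [← conjR_matrix D, AlgEquiv.spectrum_eq, hD, ← conjAlgEquiv_apply Q Q' hQ hQ',
    AlgEquiv.spectrum_eq, spectrum_jordanMatrix D.size_pos]

lemma eig_ne_zero (hA : A.det ≠ 0) (b : D.Block) : D.eig b ≠ 0 := by
  intro h
  have h0 : (0 : ℂ) ∈ spectrum ℂ (toComplex A) := by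
    rw [spectrum_eq D, ← h]
    exact Set.mem_range_self b
  exact spectrum.zero_notMem ℂ (isUnit_toComplex hA) h0

lemma isPrimaryRoot_iff {p : ℕ} (hp : p ≠ 0) (hA : A.det ≠ 0) (X : Matrix (Fin n) (Fin n) ℂ) :
    IsPrimaryRoot p A X ↔ ∃ j : D.Block → Fin p, D.Consistent j ∧ X = D.root j := by
  have he := D.eig_ne_zero hA
  obtain ⟨Y, rfl⟩ := D.conjR.surjective X
  simp only [IsPrimaryRoot, isRoot_conjR_iff, conjR_eq_aeval_iff, ← conjR_branchMatrix,
    D.conjR.injective.eq_iff]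
  constructor
  · rintro ⟨h, q, rfl⟩
    obtain ⟨j, hj⟩ := D.exists_branchMatrix_of_aeval hp he h
    exact ⟨j, (D.branchMatrix_eq_aeval_iff hp he j).1 ⟨q, hj.symm⟩, hj⟩
  · rintro ⟨j, hj, rfl⟩
    exact ⟨D.branchMatrix_pow hp he j, (D.branchMatrix_eq_aeval_iff hp he j).2 hj⟩

lemma isNonprimaryRoot_iff {p : ℕ} (hp : p ≠ 0) (hA : A.det ≠ 0) (X : Matrix (Fin n) (Fin n) ℂ) :
    IsNonprimaryRoot p A X ↔ ∃ (j : D.Block → Fin p) (U : Matrix D.Idx D.Idx ℂ),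
      (∃ b b' : D.Block, D.eig b = D.eig b' ∧ j b ≠ j b') ∧
      IsUnit U ∧ U * toComplex D.matrix = toComplex D.matrix * U ∧ X = D.rootConj j U := by
  have he := D.eig_ne_zero hA
  have hcons : ∀ j : D.Block → Fin p,
      (∃ b b' : D.Block, D.eig b = D.eig b' ∧ j b ≠ j b') ↔ ¬ D.Consistent j := by
    intro j
    simp only [RealJordanData.Consistent]
    push Not
    rfl
  obtain ⟨Y, rfl⟩ := D.conjR.surjective X
  simp only [IsNonprimaryRoot, isRoot_conjR_iff, conjR_eq_aeval_iff, ← conjR_conj_branchMatrix,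
    D.conjR.injective.eq_iff, hcons]
  -- conjugation by `U` fixes the polynomials in a matrix that commutes with `U`
  have hfix : ∀ (U : Matrix D.Idx D.Idx ℂ) (j : D.Block → Fin p), IsUnit U →
      U * toComplex D.matrix = toComplex D.matrix * U →
      ((∃ q : Polynomial ℂ,
          U * D.branchMatrix j * U⁻¹ = Polynomial.aeval (toComplex D.matrix) q) ↔
        D.Consistent j) ∧
      U * toComplex D.matrix * U⁻¹ = toComplex D.matrix := by
    intro U j hU hc
    have hd := (isUnit_iff_isUnit_det U).1 hU
    have hconj : conjAlgEquiv U U⁻¹ (mul_nonsing_inv U hd) (nonsing_inv_mul U hd)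
        (toComplex D.matrix) = toComplex D.matrix := by
      rw [conjAlgEquiv_apply, hc, mul_nonsing_inv_cancel_right _ _ hd]
    refine ⟨?_, hconj⟩
    rw [← D.branchMatrix_eq_aeval_iff hp he j]
    refine exists_congr fun q => ?_
    rw [← conjAlgEquiv_apply U U⁻¹ (mul_nonsing_inv U hd) (nonsing_inv_mul U hd)]
    conv_lhs => rw [← hconj]
    rw [Polynomial.aeval_algHom_apply, (AlgEquiv.injective _).eq_iff]
  constructor
  · rintro ⟨h, hq⟩
    obtain ⟨j, U, hU, hc, rfl⟩ := D.exists_conj_branchMatrix hp he h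
    exact ⟨j, U, fun hj => hq ((hfix U j hU hc).1.2 hj), hU, hc, rfl⟩
  · rintro ⟨j, U, hj, hU, hc, rfl⟩
    refine ⟨?_, fun hq => hj ((hfix U j hU hc).1.1 hq)⟩
    have hd := (isUnit_iff_isUnit_det U).1 hU
    rw [← conjAlgEquiv_apply U U⁻¹ (mul_nonsing_inv U hd) (nonsing_inv_mul U hd), ← map_pow,
      D.branchMatrix_pow hp he j, conjAlgEquiv_apply]
    exact (hfix U j hU hc).2

lemma ncard_isPrimaryRoot (D : RealJordanForm A) {p : ℕ} (hp : p ≠ 0) (hA : A.det ≠ 0) :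
    {X | IsPrimaryRoot p A X}.ncard = p ^ numEig A := by
  obtain ⟨Q, Q', hQ, hQ', hD, -⟩ := D.exists_complex_form
  rw [numEig, spectrum_eq D, ← ncard_primary hp D.size_pos (D.eig_ne_zero hA),
    ← Set.ncard_image_of_injective _ ((conjAlgEquiv Q Q' hQ hQ').trans D.conjR).injective]
  congr 1
  ext X
  obtain ⟨Y, rfl⟩ := ((conjAlgEquiv Q Q' hQ hQ').trans D.conjR).surjective X
  rw [((conjAlgEquiv Q Q' hQ hQ').trans D.conjR).injective.mem_set_image]
  simp only [Set.mem_ofPred_eq, AlgEquiv.trans_apply, IsPrimaryRoot, isRoot_conjR_iff,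
    conjR_eq_aeval_iff]
  rw [hD]
  simp only [← conjAlgEquiv_apply Q Q' hQ hQ', Polynomial.aeval_algHom_apply,
    (conjAlgEquiv Q Q' hQ hQ').injective.eq_iff, ← map_pow]

/-- With fewer eigenvalues than complex Jordan blocks, two blocks share an eigenvalue and can be
given different branches. -/
lemma exists_isNonprimaryRoot {p : ℕ} (hp : 1 < p) (hA : A.det ≠ 0)
    (h : numEig A < D.numBlocks) : ∃ X : Matrix (Fin n) (Fin n) ℂ, IsNonprimaryRoot p A X := by
  have hinj : ¬ Function.Injective D.eig := by
    intro hi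
    refine h.ne ?_
    rw [numEig, spectrum_eq D, ← Nat.card_coe_set_eq, ← Nat.card_congr (Equiv.ofInjective _ hi)]
    simp [RealJordanData.numBlocks, mul_comm]
  obtain ⟨b, b', hb, hne⟩ := Function.not_injective_iff.1 hinj
  refine ⟨D.rootConj (Function.update (fun _ => ⟨0, by omega⟩) b ⟨1, hp⟩) 1,
    (D.isNonprimaryRoot_iff (by omega) hA _).2 ⟨_, 1, ⟨b, b', hb, ?_⟩, isUnit_one, by simp, rfl⟩⟩
  rw [Function.update_self, Function.update_of_ne hne.symm]
  simp

end RealJordanForm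

end MatrixRoots

theorem theorem2p7 (n p : ℕ) (hp : 1 < p) (A : Matrix (Fin n) (Fin n) ℝ) (hA : A.det ≠ 0) :
    Nonempty (MatrixRoots.RealJordanForm A) ∧
    {X | MatrixRoots.IsPrimaryRoot p A X}.ncard = p ^ MatrixRoots.numEig A ∧
    ∀ D : MatrixRoots.RealJordanForm A,
      (∀ X : Matrix (Fin n) (Fin n) ℂ,
        MatrixRoots.IsPrimaryRoot p A X ↔
          ∃ j : D.Block → Fin p, D.Consistent j ∧ X = D.root j) ∧
      (MatrixRoots.numEig A < D.numBlocks →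
        ∃ X : Matrix (Fin n) (Fin n) ℂ, MatrixRoots.IsNonprimaryRoot p A X) ∧
      (∀ X : Matrix (Fin n) (Fin n) ℂ,
        MatrixRoots.IsNonprimaryRoot p A X ↔
          ∃ (j : D.Block → Fin p) (U : Matrix D.Idx D.Idx ℂ),
            (∃ b b' : D.Block, D.eig b = D.eig b' ∧ j b ≠ j b') ∧
            IsUnit U ∧ U * MatrixRoots.toComplex D.matrix = MatrixRoots.toComplex D.matrix * U ∧
            X = D.rootConj j U) := by
  have hp0 : p ≠ 0 := by omega
  obtain ⟨D⟩ := MatrixRoots.nonempty_realJordanForm A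
  exact ⟨⟨D⟩, D.ncard_isPrimaryRoot hp0 hA, fun D => ⟨D.isPrimaryRoot_iff hp0 hA,
    D.exists_isNonprimaryRoot hp hA, D.isNonprimaryRoot_iff hp0 hA⟩⟩
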